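/- Let $n\ge 1$. A Wajsberg algebra is an algebra $\langle A,\to,\neg,1\rangle$ satisfying $1\to x=x$, $(x\to y)\to((y\to z)\to(x\to z))=1$, $(x\to y)\to y=(y\to x)\to x$ and $(\neg y\to\neg x)\to(x\to y)=1$; Wajsberg algebras are MV-algebras presented with $\to$ instead of $\oplus$. Put $x\vee y=(x\to y)\to y$, $x\odot y=\neg(x\to\neg y)$, and let $B(A)=\{x\in A: x\odot x=x\}$, a Boolean algebra. The interval $[0,1]$ is a Wajsberg algebra with $x\to y=\min\{1,1-x+y\}$ and $\neg x=1-x$, and $L_{d+1}=\{0,\frac1d,\dots,1\}$ is a subalgebra of it for $d\ge 1$. An algebra is $(n+1)$-valued if it lies in the variety generated by $L_{n+1}$. For $1\le i\le n$, $\sigma_i$ is the unary term operation with $\sigma_i(\frac jn)=1$ if $i+j>n$ and $\sigma_i(\frac jn)=0$ otherwise on $L_{n+1}$; on an arbitrary Wajsberg algebra, $\sigma_i$ is computed by the fixed term $\ell_{n,n-i}$, where $\ell_{0,b}(x)=1$ if $b<0$ and $0$ otherwise, and $\ell_{a+1,b}(x)=(\ell_{a,b}(x)\oplus x)\odot\ell_{a,b-1}(x)$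 with $x\oplus y=\neg x\to y$ and $0=\neg 1$. A set $F\ni 1$ is an implicative filter of $A$ if $a,a\to b\in F$ implies $b\in F$; it is prime if it is a prime filter of the lattice $A$. Write $A/P\subseteq L_{d+1}$ if $A/P$ is isomorphic to a subalgebra of $L_{d+1}$. For a positive divisor $d$ of $n$ let $h_A(d)=B(A)\cap\bigcap\{P: P\text{ a prime implicative filter of }A,\ A/P\subseteq L_{d+1}\}$, a filter of $B(A)$. For a Boolean algebra $B$ and a map $h$ from the positive divisors of $n$ to the filters of $B$ (the improper filter is allowed), $\langle B,h\rangle\in B^{n+1}$ means that $h(n)=\{1\}$ and $h(\gcd(d,r))=h(d)\vee h(r)$ in the lattice of filters. Two such pairs are isomorphic if there is a Boolean isomorphism $\varphi:B_1\to B_2$ with $\varphi^{-1}(h_2(d))=h_1(d)$ for all $d$. $B^{[n]}$ is the Wajsberg algebra of the monotone functions $f:\{1,\dots,n\}\to B$ with $(f\to g)(k)=\bigwedge_{i=1}^{n-k+1}(f(i)\to g(i+k-1))$, $(\neg f)(k)=\neg f(n+1-k)$ and the constant function $1$. $M(B,h)$ is its subalgebra of those $f$ with $f(q\frac nd)\to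 f((q-1)\frac nd+1)\in h(d)$ for all $d\mid n$ and $1\le q\le d$. An $(n+1)$-valued Boolean space is a pair $\langle X,h\rangle$ of a compact Hausdorff totally disconnected space $X$ and a map $h$ from the positive divisors of $n$ to the closed subsets of $X$ with $h(\gcd(d,r))=h(d)\cap h(r)$ and $h(n)=X$. $\langle X,h\rangle$ and $\langle Y,g\rangle$ are isomorphic if there is a homeomorphism $\varphi:X\to Y$ with $\varphi^{-1}(g(d))=h(d)$ for all $d$. $C(X,h)$ is the algebra, with pointwise operations, of the continuous functions $f:X\to L_{n+1}$ with $f(h(d))\subseteq L_{d+1}$ for all $d\mid n$. $\langle X,h\rangle$ represents $A$ if it is an $(n+1)$-valued Boolean space and $A\cong C(X,h)$. The Stone space $\chi(B)$ is the set of prime filters of $B$ with the topology with basis $s(a)=\{U: a\in U\}$, $a\in B$, and $\delta(F)=\bigcap\{s(x):x\in F\}$ for a filter $F$ of $B$. For a Wajsberg algebra $A$ consider two statements. (I) $x\mapsto(\sigma_1(x),\dots,\sigma_n(x))$ is an isomorphism from $A$ onto $M(B(A),h_A)$. (II) There is an $(n+1)$-valued Boolean space that represents $A$, any two that represent $A$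 are isomorphic, and the underlying space of each is homeomorphic to $\chi(B(A))$. Then the following hold. 1. For every Wajsberg algebra $A$, (I) and (II) are equivalent. 2. If $A$ is $(n+1)$-valued, then both (I) and (II) hold; moreover $\langle B(A),h_A\rangle\in B^{n+1}$ and $\langle\chi(B(A)),\delta\circ h_A\rangle$ represents $A$. 3. Let $\langle B,h\rangle\in B^{n+1}$. Then $\langle B,h\rangle$ is isomorphic to $\langle B(A),h_A\rangle$ for $A=M(B,h)$, and consequently for every Wajsberg algebra $A$ isomorphic to $C(\chi(B),\delta\circ h)$. 4. For every Boolean algebra $B$, $\delta$ is an order-antiisomorphism from the filters of $B$ onto the closed subsets of $\chi(B)$. 5. Let $\langle B,h\rangle\in B^{n+1}$ (for instance $B=B(A)$). Then $\langle\chi(B),\delta\circ h\rangle$ is an $(n+1)$-valued Boolean space, and the map $\Psi:M(B,h)\to C(\chi(B),\delta\circ h)$, $\Psi(g)=\widetilde g$, is a well-defined isomorphism of Wajsberg algebras, where, with $S_i=s(g(i))$, $\widetilde g(U)=1$ if $U\in S_1$, $\widetilde g(U)=\frac kn$ if $U\in S_{n-k+1}\setminus S_{n-k}$ for $1\le k\le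 n-1$, and $\widetilde g(U)=0$ if $U\notin S_n$. -/

import Mathlib

open Order

universe u v w

/-! ### Wajsberg algebras -/

/-- Wajsberg algebras `⟨A, →, ¬, 1⟩`. -/
class WajsbergAlgebra (A : Type*) where
  imp : A → A → A
  neg : A → A
  one : A
  one_imp : ∀ x, imp one x = x
  imp_trans : ∀ x y z, imp (imp x y) (imp (imp y z) (imp x z)) = one
  imp_imp_comm : ∀ x y, imp (imp x y) y = imp (imp y x) x
  contra : ∀ x y, imp (imp (neg y) (neg x)) (imp x y) = one

namespace WajsbergAlgebra

infixr:60 "⇝" => WajsbergAlgebra.imp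
prefix:max "∼" => WajsbergAlgebra.neg

section Basic

variable {A : Type*} [WajsbergAlgebra A]

/-- `0 = ¬1`. -/
def zero : A := ∼(one : A)

/-- `x ∨ y = (x → y) → y`. -/
def vee (x y : A) : A := (x ⇝ y) ⇝ y

/-- `x ∧ y = ¬(¬x ∨ ¬y)`. -/
def wedge (x y : A) : A := ∼(vee ∼x ∼y)

/-- `x ⊕ y = ¬x → y`. -/
def oplus (x y : A) : A := ∼x ⇝ y

/-- `x ⊙ y = ¬(x → ¬y)`. -/
def odot (x y : A) : A := ∼(x ⇝ ∼y)

/-- The order: `x ≤ y` if and only if `x → y = 1`. -/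
def Le (x y : A) : Prop := x ⇝ y = one

theorem le_rfl' (x : A) : Le x x := by
  have h := imp_trans (one : A) one x
  simpa [one_imp, Le] using h

theorem Le.antisymm {x y : A} (h : Le x y) (h' : Le y x) : x = y := by
  have e := imp_imp_comm x y
  unfold Le at h h'
  rw [h, h', one_imp, one_imp] at e
  exact e.symm

theorem one_le {x : A} (h : Le one x) : x = one := by
  unfold Le at h
  rwa [one_imp] at h

theorem Le.trans {x y z : A} (h : Le x y) (h' : Le y z) : Le x z := by
  have e := imp_trans x y z
  unfold Le at *
  rwa [h, h', one_imp, one_imp] at e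

theorem imp_antitone {x y : A} (z : A) (h : Le x y) : Le (y ⇝ z) (x ⇝ z) := by
  have e := imp_trans x y z
  unfold Le at *
  rwa [h, one_imp] at e

theorem le_one (x : A) : Le x one := by
  have h1 : (x ⇝ one) ⇝ one = (one : A) := by
    rw [imp_imp_comm, one_imp]; exact le_rfl' x
  have h2 := imp_trans (one : A) x one
  rw [one_imp, one_imp, h1] at h2
  exact h2

theorem le_imp (x y : A) : Le x (y ⇝ x) := by
  have h := imp_trans y one x
  rw [show y ⇝ one = (one : A) from le_one y, one_imp, one_imp] at h
  exact h

theorem le_vee_right (x y : A) : Le y (vee x y) := le_imp _ _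

theorem vee_comm (x y : A) : vee x y = vee y x := imp_imp_comm x y

theorem le_vee_left (x y : A) : Le x (vee x y) := by
  rw [vee_comm]; exact le_vee_right y x

theorem exch_le (x y z : A) : Le (x ⇝ y ⇝ z) (y ⇝ x ⇝ z) :=
  Le.trans (imp_trans x (y ⇝ z) z) (imp_antitone _ (le_vee_left y z))

theorem exch (x y z : A) : x ⇝ y ⇝ z = y ⇝ x ⇝ z :=
  (exch_le x y z).antisymm (exch_le y x z)

theorem imp_trans' (x y z : A) : Le (y ⇝ z) ((x ⇝ y) ⇝ (x ⇝ z)) := by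
  have h := imp_trans x y z
  unfold Le
  rwa [exch] at h

theorem imp_mono {y z : A} (x : A) (h : Le y z) : Le (x ⇝ y) (x ⇝ z) := by
  have e := imp_trans' x y z
  unfold Le at *
  rwa [h, one_imp] at e

theorem neg_neg_le (x : A) : Le ∼∼x x := by
  have h1 : Le ∼∼x (∼∼(one : A) ⇝ ∼∼x) := le_imp _ _
  have h2 : Le (∼∼(one : A) ⇝ ∼∼x) (∼x ⇝ ∼(one : A)) := contra _ _
  have h3 : Le (∼x ⇝ ∼(one : A)) (one ⇝ x) := contra _ _
  rw [one_imp] at h3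
  exact h1.trans (h2.trans h3)

theorem neg_neg' (x : A) : ∼∼x = x := by
  refine (neg_neg_le x).antisymm ?_
  have h := contra x (∼∼x)
  rw [show ∼∼(∼x) ⇝ ∼x = (one : A) from neg_neg_le ∼x, one_imp] at h
  exact h

theorem neg_imp_neg (x y : A) : ∼y ⇝ ∼x = x ⇝ y := by
  refine Le.antisymm (contra x y) ?_
  have h := contra ∼y ∼x
  rwa [neg_neg', neg_neg'] at h

theorem neg_antitone {x y : A} (h : Le x y) : Le ∼y ∼x := by
  unfold Le; rw [neg_imp_neg]; exact h

theorem imp_zero (x : A) : x ⇝ zero = ∼x := by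
  unfold zero
  rw [← neg_imp_neg, neg_neg', one_imp]

theorem zero_le' (x : A) : Le zero x := by
  unfold Le zero
  rw [← neg_imp_neg, neg_neg']
  exact le_one _

theorem vee_le {x y z : A} (h : Le x z) (h' : Le y z) : Le (vee x y) z := by
  have h1 : Le (vee x y) (vee z y) := imp_antitone _ (imp_antitone _ h)
  rw [vee_comm z y] at h1
  unfold vee at h1
  unfold Le at h'
  rw [h', one_imp] at h1
  exact h1

theorem wedge_le_left (x y : A) : Le (wedge x y) x := by
  have := neg_antitone (le_vee_left ∼x ∼y)
  rwa [neg_neg'] at this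

theorem wedge_le_right (x y : A) : Le (wedge x y) y := by
  have := neg_antitone (le_vee_right ∼x ∼y)
  rwa [neg_neg'] at this

theorem le_wedge {x y z : A} (h : Le z x) (h' : Le z y) : Le z (wedge x y) := by
  have := neg_antitone (vee_le (neg_antitone h) (neg_antitone h'))
  rwa [neg_neg'] at this

theorem imp_neg_comm (x y : A) : x ⇝ ∼y = y ⇝ ∼x := by
  rw [← neg_imp_neg, neg_neg']

theorem odot_comm (x y : A) : odot x y = odot y x := by
  unfold odot; rw [imp_neg_comm]

theorem odot_imp (x y z : A) : odot x y ⇝ z = x ⇝ y ⇝ z := by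
  unfold odot
  rw [← neg_imp_neg, neg_neg', exch, neg_imp_neg]

theorem odot_assoc (x y z : A) : odot (odot x y) z = odot x (odot y z) := by
  have key : ∀ w : A, odot (odot x y) z ⇝ w = odot x (odot y z) ⇝ w := by
    intro w; simp only [odot_imp]
  refine Le.antisymm ?_ ?_
  · unfold Le; rw [key]; exact le_rfl' _
  · unfold Le; rw [← key]; exact le_rfl' _

theorem odot_le_left (x y : A) : Le (odot x y) x := by
  unfold Le; rw [odot_imp, exch, show x ⇝ x = (one : A) from le_rfl' x]; exact le_one y

theorem odot_le_right (x y : A) : Le (odot x y) y := by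
  rw [odot_comm]; exact odot_le_left y x

/-- Divisibility: `x ⊙ (x → z) = x ∧ z`. -/
theorem odot_imp_self (x z : A) : odot x (x ⇝ z) = wedge x z := by
  rw [odot_comm]
  unfold odot wedge
  rw [vee_comm, ← neg_imp_neg x z]
  rfl

theorem one_odot_one : odot (one : A) one = one := by
  unfold odot; rw [one_imp, neg_neg']

theorem neg_idem {x : A} (h : odot x x = x) : odot ∼x ∼x = ∼x := by
  have h1 : x ⇝ ∼x = ∼x := by
    rw [← neg_neg' (x ⇝ ∼x)]; exact congrArg neg h
  have h2 := imp_imp_comm x ∼x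
  rw [h1, show ∼x ⇝ ∼x = (one : A) from le_rfl' _] at h2
  have h3 : ∼x ⇝ x = x := Le.antisymm h2.symm (le_imp _ _)
  unfold odot
  rw [neg_neg', h3]

theorem odot_idem {x y : A} (hx : odot x x = x) (hy : odot y y = y) :
    odot (odot x y) (odot x y) = odot x y := by
  rw [odot_assoc, ← odot_assoc y x y, odot_comm y x, odot_assoc x y y, hy, ← odot_assoc, hx]

theorem wedge_eq_odot {x : A} (hx : odot x x = x) (y : A) : wedge x y = odot x y := by
  refine Le.antisymm ?_ (le_wedge (odot_le_left _ _) (odot_le_right _ _))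
  have h1 : odot x (wedge x y) = wedge x y := by
    rw [← odot_imp_self, ← odot_assoc, hx]
  rw [← h1]
  unfold odot
  exact neg_antitone (imp_mono _ (neg_antitone (wedge_le_right x y)))

theorem wedge_idem {x y : A} (hx : odot x x = x) (hy : odot y y = y) :
    odot (wedge x y) (wedge x y) = wedge x y := by
  rw [wedge_eq_odot hx]; exact odot_idem hx hy

theorem imp_idem {x y : A} (hx : odot x x = x) (hy : odot y y = y) :
    odot (x ⇝ y) (x ⇝ y) = x ⇝ y := by
  have : x ⇝ y = ∼(odot x ∼y) := by unfold odot; rw [neg_neg', neg_neg']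
  rw [this]
  exact neg_idem (odot_idem hx (neg_idem hy))

theorem vee_idem {x y : A} (hx : odot x x = x) (hy : odot y y = y) :
    odot (vee x y) (vee x y) = vee x y :=
  imp_idem (imp_idem hx hy) hy

end Basic

/-! ### The Boolean algebra of idempotents -/

/-- `B(A) = {x : x ⊙ x = x}`. -/
def BooleanPart (A : Type*) [WajsbergAlgebra A] : Type _ := {x : A // odot x x = x}

namespace BooleanPart

variable {A : Type*} [WajsbergAlgebra A]

/-- `B(A)` as a lattice, with the order and the operations of `A`. -/
instance : Lattice (BooleanPart A) where
  le x y := Le x.1 y.1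
  le_refl x := le_rfl' x.1
  le_trans _ _ _ h h' := Le.trans h h'
  le_antisymm _ _ h h' := Subtype.ext (Le.antisymm h h')
  sup x y := ⟨vee x.1 y.1, vee_idem x.2 y.2⟩
  inf x y := ⟨wedge x.1 y.1, wedge_idem x.2 y.2⟩
  le_sup_left _ _ := le_vee_left _ _
  le_sup_right _ _ := le_vee_right _ _
  sup_le _ _ _ h h' := vee_le h h'
  inf_le_left _ _ := wedge_le_left _ _
  inf_le_right _ _ := wedge_le_right _ _
  le_inf _ _ _ h h' := le_wedge h h'

/-- The Heyting algebra structure of `B(A)`, with the operations `→`, `¬`, `1` and `0` of `A`. -/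
instance instHeyting : HeytingAlgebra (BooleanPart A) where
  top := ⟨one, one_odot_one⟩
  le_top x := le_one x.1
  bot := ⟨zero, neg_idem one_odot_one⟩
  bot_le x := zero_le' x.1
  himp x y := ⟨x.1 ⇝ y.1, imp_idem x.2 y.2⟩
  compl x := ⟨∼x.1, neg_idem x.2⟩
  le_himp_iff x y z := by
    change x.1 ⇝ y.1 ⇝ z.1 = one ↔ wedge x.1 y.1 ⇝ z.1 = one
    rw [wedge_eq_odot x.2, odot_imp]
  himp_bot x := Subtype.ext (imp_zero x.1)

/-- `B(A)` is a Boolean algebra, with the operations of `A`. -/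
instance : BooleanAlgebra (BooleanPart A) :=
  BooleanAlgebra.ofRegular fun x => Subtype.ext (neg_neg' (x ⊔ xᶜ).1)

end BooleanPart

/-! ### Homomorphisms, subalgebras, products, implicative filters and quotients -/

/-- Homomorphisms of Wajsberg algebras. -/
structure Hom (A A' : Type*) [WajsbergAlgebra A] [WajsbergAlgebra A'] where
  toFun : A → A'
  map_imp : ∀ x y, toFun (x ⇝ y) = toFun x ⇝ toFun y
  map_neg : ∀ x, toFun ∼x = ∼(toFun x)
  map_one : toFun one = one

/-- Isomorphisms of Wajsberg algebras. -/
structure Iso (A A' : Type*) [WajsbergAlgebra A] [WajsbergAlgebra A'] extends A ≃ A' where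
  map_imp : ∀ x y, toFun (x ⇝ y) = toFun x ⇝ toFun y
  map_neg : ∀ x, toFun ∼x = ∼(toFun x)
  map_one : toFun one = one

/-- Subalgebras of a Wajsberg algebra. -/
structure Subalg (A : Type*) [WajsbergAlgebra A] where
  carrier : Set A
  imp_mem : ∀ {x y}, x ∈ carrier → y ∈ carrier → x ⇝ y ∈ carrier
  neg_mem : ∀ {x}, x ∈ carrier → ∼x ∈ carrier
  one_mem : one ∈ carrier

/-- The underlying type of a subalgebra. -/
def Subalg.Elem {A : Type*} [WajsbergAlgebra A] (S : Subalg A) : Type _ := {x : A // x ∈ S.carrier}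

instance {A : Type*} [WajsbergAlgebra A] (S : Subalg A) : WajsbergAlgebra S.Elem where
  imp x y := ⟨x.1 ⇝ y.1, S.imp_mem x.2 y.2⟩
  neg x := ⟨∼x.1, S.neg_mem x.2⟩
  one := ⟨one, S.one_mem⟩
  one_imp _ := Subtype.ext (one_imp _)
  imp_trans _ _ _ := Subtype.ext (imp_trans _ _ _)
  imp_imp_comm _ _ := Subtype.ext (imp_imp_comm _ _)
  contra _ _ := Subtype.ext (contra _ _)

/-- Functions with values in a Wajsberg algebra, with the pointwise operations. -/
instance {X A : Type*} [WajsbergAlgebra A] : WajsbergAlgebra (X → A) where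
  imp f g x := f x ⇝ g x
  neg f x := ∼(f x)
  one _ := one
  one_imp _ := funext fun _ => one_imp _
  imp_trans _ _ _ := funext fun _ => imp_trans _ _ _
  imp_imp_comm _ _ := funext fun _ => imp_imp_comm _ _
  contra _ _ := funext fun _ => contra _ _

/-- Implicative filters. -/
structure ImplFilter (A : Type*) [WajsbergAlgebra A] where
  carrier : Set A
  one_mem : one ∈ carrier
  mp : ∀ {a b}, a ∈ carrier → a ⇝ b ∈ carrier → b ∈ carrier

namespace ImplFilter

variable {A : Type*} [WajsbergAlgebra A] (F : ImplFilter A)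

/-- An implicative filter is prime if it is a prime filter of the lattice `A`. -/
def IsPrime : Prop :=
  F.carrier ≠ Set.univ ∧ ∀ x y, vee x y ∈ F.carrier → x ∈ F.carrier ∨ y ∈ F.carrier

variable {F} in
theorem mem_of_le {x y : A} (h : Le x y) (hx : x ∈ F.carrier) : y ∈ F.carrier :=
  F.mp hx (by unfold Le at h; rw [h]; exact F.one_mem)

/-- The congruence of an implicative filter. -/
def con : Setoid A where
  r x y := x ⇝ y ∈ F.carrier ∧ y ⇝ x ∈ F.carrier
  iseqv :=
    { refl := fun x => by
        rw [show x ⇝ x = (one : A) from le_rfl' x]; exact ⟨F.one_mem, F.one_mem⟩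
      symm := fun h => ⟨h.2, h.1⟩
      trans := fun {x y z} h h' =>
        ⟨F.mp h'.1 (mem_of_le (imp_trans x y z) h.1), F.mp h.2 (mem_of_le (imp_trans z y x) h'.2)⟩ }

theorem con_imp {x x' y y' : A} (hx : F.con x x') (hy : F.con y y') :
    F.con (x ⇝ y) (x' ⇝ y') := by
  have h1 : F.con (x ⇝ y) (x' ⇝ y) :=
    ⟨mem_of_le (imp_trans x' x y) hx.2, mem_of_le (imp_trans x x' y) hx.1⟩
  have h2 : F.con (x' ⇝ y) (x' ⇝ y') :=
    ⟨mem_of_le (imp_trans' x' y y') hy.1, mem_of_le (imp_trans' x' y' y) hy.2⟩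
  exact F.con.iseqv.trans h1 h2

/-- The quotient `A/F`. -/
def Quot : Type _ := Quotient F.con

instance : WajsbergAlgebra F.Quot where
  imp := Quotient.map₂ imp fun _ _ hx _ _ hy => F.con_imp hx hy
  neg := Quotient.map neg fun x x' hx =>
    ⟨by rw [neg_imp_neg]; exact hx.2, by rw [neg_imp_neg]; exact hx.1⟩
  one := Quotient.mk _ one
  one_imp := by rintro ⟨x⟩; exact congrArg (Quotient.mk _) (one_imp x)
  imp_trans := by rintro ⟨x⟩ ⟨y⟩ ⟨z⟩; exact congrArg (Quotient.mk _) (imp_trans x y z)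
  imp_imp_comm := by rintro ⟨x⟩ ⟨y⟩; exact congrArg (Quotient.mk _) (imp_imp_comm x y)
  contra := by rintro ⟨x⟩ ⟨y⟩; exact congrArg (Quotient.mk _) (contra x y)

end ImplFilter

/-! ### The algebra `[0,1]`, its subalgebras `L_{d+1}`, and `(n+1)`-valued algebras -/

/-- `[0,1]` with `x → y = min {1, 1 - x + y}` and `¬x = 1 - x`. -/
noncomputable instance : WajsbergAlgebra unitInterval where
  imp x y := ⟨min 1 (1 - x.1 + y.1), le_min zero_le_one (by linarith [x.2.2, y.2.1]),
    min_le_left _ _⟩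
  neg x := ⟨1 - x.1, by linarith [x.2.2], by linarith [x.2.1]⟩
  one := ⟨1, zero_le_one, le_rfl⟩
  one_imp x := Subtype.ext (by simpa using x.2.2)
  imp_trans x y z := Subtype.ext (by
    obtain ⟨⟨x, _, _⟩, ⟨y, _, _⟩, ⟨z, _, _⟩⟩ := x, y, z
    simp only [min_def]; split_ifs <;> linarith)
  imp_imp_comm x y := Subtype.ext (by
    obtain ⟨⟨x, _, _⟩, ⟨y, _, _⟩⟩ := x, y
    simp only [min_def]; split_ifs <;> linarith)
  contra x y := Subtype.ext (by
    obtain ⟨⟨x, _, _⟩, ⟨y, _, _⟩⟩ := x, y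
    simp only [min_def]; split_ifs <;> linarith)

/-- `L_{d+1} = {0, 1/d, 2/d, …, 1}`, the universe of a subalgebra of `[0,1]` when `d ≥ 1`. -/
def Luk (d : ℕ) : Set unitInterval := {x | ∃ k : ℕ, k ≤ d ∧ (x : ℝ) = k / d}

theorem one_mem_Luk {d : ℕ} (hd : 0 < d) : one ∈ Luk d :=
  ⟨d, le_rfl, (div_self (by positivity)).symm⟩

theorem neg_mem_Luk {d : ℕ} (hd : 0 < d) {x : unitInterval} (hx : x ∈ Luk d) : ∼x ∈ Luk d := by
  obtain ⟨k, hk, e⟩ := hx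
  refine ⟨d - k, by omega, ?_⟩
  change 1 - (x : ℝ) = _
  rw [e, Nat.cast_sub hk]
  field_simp

theorem imp_mem_Luk {d : ℕ} (hd : 0 < d) {x y : unitInterval} (hx : x ∈ Luk d) (hy : y ∈ Luk d) :
    x ⇝ y ∈ Luk d := by
  obtain ⟨k, hk, e⟩ := hx
  obtain ⟨l, hl, e'⟩ := hy
  have hd' : (0 : ℝ) < d := by exact_mod_cast hd
  refine ⟨min d (d - k + l), min_le_left _ _, ?_⟩
  change min 1 (1 - (x : ℝ) + y) = _
  rw [e, e', Nat.cast_min, ← min_div_div_right hd'.le]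
  push_cast [Nat.cast_sub hk]
  congr 1 <;> field_simp

/-- `A` is isomorphic to a subalgebra of `L_{d+1}` (written `A ⊆ L_{d+1}`). -/
def EmbedsInLuk (A : Type*) [WajsbergAlgebra A] (d : ℕ) : Prop :=
  ∃ g : Hom A unitInterval, Function.Injective g.toFun ∧ ∀ x, g.toFun x ∈ Luk d

/-- Terms in the language of Wajsberg algebras. -/
inductive Term : Type
  | var : ℕ → Term
  | imp : Term → Term → Term
  | neg : Term → Term
  | one : Term

/-- The value of a term under an assignment of the variables. -/
def Term.eval {A : Type*} [WajsbergAlgebra A] (v : ℕ → A) : Term → A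
  | .var i => v i
  | .imp s t => s.eval v ⇝ t.eval v
  | .neg t => ∼(t.eval v)
  | .one => WajsbergAlgebra.one

/-- `A` is an `(n+1)`-valued Wajsberg algebra: it belongs to the variety generated by `L_{n+1}`,
that is, it satisfies all the identities that hold in `L_{n+1}`. -/
def IsValued (n : ℕ) (A : Type*) [WajsbergAlgebra A] : Prop :=
  ∀ s t : Term,
    (∀ v : ℕ → unitInterval, (∀ i, v i ∈ Luk n) → s.eval v = t.eval v) →
      ∀ v : ℕ → A, s.eval v = t.eval v

/-! ### The operators `σ_i` -/

/-- A unary term operation which on `[0,1]` is the truncation to `[0,1]` of `a x - b`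
(see `lin_unitInterval`). -/
def lin {A : Type*} [WajsbergAlgebra A] : ℕ → ℤ → A → A
  | 0, b, _ => if b < 0 then one else zero
  | a + 1, b, x => odot (oplus (lin a b x) x) (lin a (b - 1) x)

/-- The operators `σ_i`, `1 ≤ i ≤ n`: the unary term operation that takes the values
`σ_i (j/n) = 1` if `i + j > n` and `σ_i (j/n) = 0` otherwise on `L_{n+1}` (see `sigma_Luk`). -/
def sigma {A : Type*} [WajsbergAlgebra A] (n i : ℕ) (x : A) : A := lin n (n - i) x

theorem lin_unitInterval (a : ℕ) (b : ℤ) (x : unitInterval) :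
    ((lin a b x : unitInterval) : ℝ) = max 0 (min 1 (a * (x : ℝ) - b)) := by
  induction a generalizing b with
  | zero =>
    unfold lin
    split_ifs with h
    · have : (b : ℝ) ≤ -1 := by exact_mod_cast (by omega : b ≤ -1)
      change (1 : ℝ) = _
      rw [min_eq_left (by push_cast; linarith)]; simp
    · have : (0 : ℝ) ≤ b := by exact_mod_cast (by omega : 0 ≤ b)
      change (1 : ℝ) - 1 = _
      rw [max_eq_left]
      · simp
      · exact (min_le_right _ _).trans (by push_cast; linarith)
  | succ a ih =>
    unfold lin
    change 1 - min 1 (1 - min 1 (1 - (1 - ((lin a b x : unitInterval) : ℝ)) + x) + (1 - ((lin a (b - 1) x : unitInterval) : ℝ))) = _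
    rw [ih, ih]
    push_cast
    have h0 := x.2.1
    have h1 := x.2.2
    generalize (x : ℝ) = y at *
    have e : ((a : ℝ) + 1) * y - b = (a * y - b) + y := by ring
    have e' : (a : ℝ) * y - (b - 1) = (a * y - b) + 1 := by ring
    rw [e, e']
    generalize (a : ℝ) * y - b = t
    simp only [min_def, max_def]
    split_ifs <;> linarith

theorem sigma_Luk {n i j : ℕ} (hn : 0 < n) (x : unitInterval) (hx : (x : ℝ) = j / n) :
    ((sigma n i x : unitInterval) : ℝ) = if n < i + j then 1 else 0 := by
  unfold sigma
  rw [lin_unitInterval, hx, mul_div_cancel₀ _ (by positivity : (n : ℝ) ≠ 0)]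
  push_cast
  split_ifs with h
  · have : (n : ℝ) + 1 ≤ i + j := by exact_mod_cast h
    rw [min_eq_left (by linarith)]; simp
  · have : (i : ℝ) + j ≤ n := by exact_mod_cast not_lt.1 h
    rw [max_eq_left]
    exact (min_le_right _ _).trans (by linarith)

/-! ### The algebra `B^{[n]}` -/

/-- The index set `{1, 2, …, n}`. -/
abbrev Idx (n : ℕ) : Type := {i : ℕ // 1 ≤ i ∧ i ≤ n}

/-- `B^{[n]}`: the monotone functions from `{1, …, n}` into `B`. -/
abbrev Pow (n : ℕ) (B : Type*) [BooleanAlgebra B] : Type _ := Idx n →o B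

section Pow

variable {n : ℕ} {B : Type*} [BooleanAlgebra B]

/-- `(f → g)(k) = ⋀_{i=1}^{n-k+1} (f(i) → g(i+k-1))`. -/
def powImpFun (f g : Idx n → B) (k : Idx n) : B :=
  (Finset.Icc 1 (n - k.1 + 1)).attach.inf fun i =>
    have hi := Finset.mem_Icc.1 i.2
    have hk := k.2
    f ⟨i.1, by omega⟩ ⇨ g ⟨i.1 + k.1 - 1, by omega⟩

/-- `(¬f)(k) = ¬f(n+1-k)`. -/
def powNegFun (f : Idx n → B) (k : Idx n) : B := (f ⟨n + 1 - k.1, by have := k.2; omega⟩)ᶜ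

theorem le_powImpFun {f g : Idx n → B} {k : Idx n} {b : B} :
    b ≤ powImpFun f g k ↔ ∀ i j : Idx n, j.1 + 1 = i.1 + k.1 → b ≤ f i ⇨ g j := by
  unfold powImpFun
  rw [Finset.le_inf_iff]
  constructor
  · rintro h ⟨i, hi⟩ ⟨j, hj⟩ e
    dsimp only at e
    have hk := k.2
    have := h ⟨i, Finset.mem_Icc.2 (by omega)⟩ (Finset.mem_attach _ _)
    simpa only [show i + k.1 - 1 = j by omega] using this
  · rintro h ⟨i, hi⟩ -
    have hi' := Finset.mem_Icc.1 hi
    have hk := k.2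
    exact h _ _ (by dsimp only; omega)

theorem powImpFun_mono (f : Idx n → B) (g : Idx n →o B) : Monotone (powImpFun f g) := by
  intro k l hkl
  rw [le_powImpFun]
  intro i j e
  have hkl' : k.1 ≤ l.1 := hkl
  have hi := i.2
  have hj := j.2
  have hk := k.2
  refine (le_powImpFun.1 le_rfl i ⟨i.1 + k.1 - 1, by omega⟩ (by dsimp only; omega)).trans ?_
  exact himp_le_himp_left (g.monotone (by change i.1 + k.1 - 1 ≤ j.1; omega))

/-- The implication of `B^{[n]}`. -/
def powImp (f g : Pow n B) : Pow n B := ⟨powImpFun f g, powImpFun_mono f g⟩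

/-- The negation of `B^{[n]}`. -/
def powNeg (f : Pow n B) : Pow n B :=
  ⟨powNegFun f, fun k l h => compl_le_compl (f.monotone (by
    change n + 1 - l.1 ≤ n + 1 - k.1
    have h' : k.1 ≤ l.1 := h
    omega))⟩

/-- The constant function `1`. -/
def powOne : Pow n B := ⟨fun _ => ⊤, fun _ _ _ => le_rfl⟩

/-- A Boolean homomorphism from `B` into the truth values. -/
structure IsPt (p : B → Prop) : Prop where
  inf : ∀ a b, p (a ⊓ b) ↔ p a ∧ p b
  compl : ∀ a, p aᶜ ↔ ¬p a
  top : p ⊤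

theorem IsPt.mono {p : B → Prop} (hp : IsPt p) {a b : B} (h : a ≤ b) (ha : p a) : p b := by
  rw [← inf_eq_left.2 h, hp.inf] at ha
  exact ha.2

theorem IsPt.himp {p : B → Prop} (hp : IsPt p) (a b : B) : p (a ⇨ b) ↔ (p a → p b) := by
  have : a ⇨ b = (a ⊓ bᶜ)ᶜ := by rw [compl_inf, compl_compl, himp_eq, sup_comm]
  rw [this, hp.compl, hp.inf, hp.compl]
  tauto

theorem exists_pt {a b : B} (h : ¬a ≤ b) : ∃ p : B → Prop, IsPt p ∧ p a ∧ ¬p b := by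
  have hd : Disjoint (PFilter.principal a : Set B) (Ideal.principal b : Set B) := by
    rw [Set.disjoint_left]
    intro x hx hx'
    exact h (le_trans (PFilter.mem_principal.1 hx) (Ideal.mem_principal.1 hx'))
  obtain ⟨J, hJ, hI, hF⟩ := DistribLattice.prime_ideal_of_disjoint_filter_ideal hd
  refine ⟨fun x => x ∉ J, ⟨fun x y => ?_, fun x => ?_, fun ht => ?_⟩, ?_, ?_⟩
  · constructor
    · exact fun hxy => ⟨fun hx => hxy (J.lower inf_le_left hx), fun hy => hxy (J.lower inf_le_right hy)⟩
    · rintro ⟨hx, hy⟩ hxy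
      exact (hJ.mem_or_mem hxy).elim hx hy
  · constructor
    · intro hx
      rw [not_not]
      exact hJ.mem_or_compl_mem.resolve_right hx
    · intro hx hx'
      rw [not_not] at hx
      exact hJ.1.top_notMem (by
        have := Order.Ideal.sup_mem hx hx'; rwa [sup_compl_eq_top] at this)
  · exact hJ.1.top_notMem ht
  · exact Set.disjoint_left.1 hF (PFilter.mem_principal.2 le_rfl)
  · exact fun hb => hb (hI (Ideal.mem_principal.2 le_rfl))

theorem IsPt.powImpFun {p : B → Prop} (hp : IsPt p) (f g : Idx n → B) (k : Idx n) :
    p (powImpFun f g k) ↔ ∀ i j : Idx n, j.1 + 1 = i.1 + k.1 → p (f i) → p (g j) := by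
  have hinf : ∀ {ι : Type} (s : Finset ι) (u : ι → B), p (s.inf u) ↔ ∀ i ∈ s, p (u i) := by
    intro ι s u
    classical
    induction s using Finset.induction_on with
    | empty => simp [hp.top]
    | insert a s ha ih => rw [Finset.inf_insert, hp.inf, ih]; simp
  constructor
  · intro h i j e hi
    have := hp.mono (le_powImpFun.1 le_rfl i j e) h
    exact (hp.himp _ _).1 this hi
  · intro h
    unfold WajsbergAlgebra.powImpFun
    rw [hinf]
    rintro ⟨i, hi⟩ -
    have hi' := Finset.mem_Icc.1 hi
    have hk := k.2
    rw [hp.himp]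
    exact h _ _ (by dsimp only; omega)

/-- Under a Boolean homomorphism into the truth values, a monotone function is a threshold. -/
def IsCut (p : B → Prop) (f : Pow n B) (v : ℕ) : Prop := v ≤ n ∧ ∀ i : Idx n, p (f i) ↔ v < i.1

theorem IsPt.exists_cut {p : B → Prop} (hp : IsPt p) (f : Pow n B) : ∃ v, IsCut p f v := by
  classical
  have hex : ∃ v, v = n ∨ ∃ h : v < n, p (f ⟨v + 1, by omega⟩) := ⟨n, Or.inl rfl⟩
  have hle : Nat.find hex ≤ n := Nat.find_le (Or.inl rfl)
  refine ⟨Nat.find hex, hle, fun i => ⟨fun hi => ?_, fun hi => ?_⟩⟩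
  · have := i.2
    have h1 : Nat.find hex ≤ i.1 - 1 := by
      refine Nat.find_le (Or.inr ⟨by omega, ?_⟩)
      have : (⟨i.1 - 1 + 1, by omega⟩ : Idx n) = i := Subtype.ext (by dsimp only; omega)
      rwa [this]
    omega
  · have := i.2
    rcases Nat.find_spec hex with h | ⟨h, h'⟩
    · omega
    · exact hp.mono (f.monotone (show Nat.find hex + 1 ≤ i.1 by omega)) h'

theorem IsPt.cut_imp {p : B → Prop} (hp : IsPt p) {f g : Pow n B} {v w : ℕ} (hf : IsCut p f v)
    (hg : IsCut p g w) : IsCut p (powImp f g) (w - v) := by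
  obtain ⟨hv, hf⟩ := hf
  obtain ⟨hw, hg⟩ := hg
  refine ⟨by omega, fun k => ?_⟩
  change p (WajsbergAlgebra.powImpFun f g k) ↔ _
  rw [hp.powImpFun]
  have hk := k.2
  constructor
  · intro h
    by_contra hc
    have h1 := h ⟨v + 1, by omega⟩ ⟨v + k.1, by omega⟩ (by dsimp only; omega)
    rw [hf, hg] at h1
    have := h1 (by dsimp only; omega)
    dsimp only at this
    omega
  · intro h i j e hi
    rw [hf] at hi
    rw [hg]
    omega

theorem IsPt.cut_neg {p : B → Prop} (hp : IsPt p) {f : Pow n B} {v : ℕ} (hf : IsCut p f v) :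
    IsCut p (powNeg f) (n - v) := by
  obtain ⟨hv, hf⟩ := hf
  refine ⟨by omega, fun k => ?_⟩
  have hk := k.2
  change p (f ⟨n + 1 - k.1, _⟩)ᶜ ↔ _
  rw [hp.compl, hf]
  dsimp only
  omega

theorem IsPt.cut_one {p : B → Prop} (hp : IsPt p) : IsCut p (powOne : Pow n B) 0 :=
  ⟨by omega, fun k => ⟨fun _ => by have := k.2; omega, fun _ => hp.top⟩⟩

theorem IsCut.unique {p : B → Prop} {f : Pow n B} {v w : ℕ} (h : IsCut p f v) (h' : IsCut p f w) :
    v = w := by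
  obtain ⟨hv, h⟩ := h
  obtain ⟨hw, h'⟩ := h'
  rcases lt_trichotomy v w with hlt | he | hlt
  · have := (h ⟨w, by omega⟩).symm.trans (h' ⟨w, by omega⟩)
    dsimp only at this; omega
  · exact he
  · have := (h ⟨v, by omega⟩).symm.trans (h' ⟨v, by omega⟩)
    dsimp only at this; omega

theorem pow_ext {f g : Pow n B}
    (h : ∀ p : B → Prop, IsPt p → ∀ v w, IsCut p f v → IsCut p g w → v = w) : f = g := by
  have key : ∀ p : B → Prop, IsPt p → ∀ i, p (f i) ↔ p (g i) := by
    intro p hp i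
    obtain ⟨v, hv⟩ := hp.exists_cut f
    obtain ⟨w, hw⟩ := hp.exists_cut g
    rw [hv.2, hw.2, h p hp v w hv hw]
  refine OrderHom.ext _ _ (funext fun i => le_antisymm ?_ ?_)
  · by_contra hc
    obtain ⟨p, hp, h1, h2⟩ := exists_pt hc
    exact h2 ((key p hp i).1 h1)
  · by_contra hc
    obtain ⟨p, hp, h1, h2⟩ := exists_pt hc
    exact h2 ((key p hp i).2 h1)

/-- `B^{[n]}` is a Wajsberg algebra. -/
instance : WajsbergAlgebra (Pow n B) where
  imp := powImp
  neg := powNeg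
  one := powOne
  one_imp f := pow_ext fun p hp v w hv hw => by
    have := hv.unique (hp.cut_imp hp.cut_one hw); omega
  imp_trans f g k := pow_ext fun p hp v w hv hw => by
    obtain ⟨a, ha⟩ := hp.exists_cut f
    obtain ⟨b, hb⟩ := hp.exists_cut g
    obtain ⟨c, hc⟩ := hp.exists_cut k
    have h1 := hv.unique (hp.cut_imp (hp.cut_imp ha hb)
      (hp.cut_imp (hp.cut_imp hb hc) (hp.cut_imp ha hc)))
    have h2 := hw.unique hp.cut_one
    omega
  imp_imp_comm f g := pow_ext fun p hp v w hv hw => by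
    obtain ⟨a, ha⟩ := hp.exists_cut f
    obtain ⟨b, hb⟩ := hp.exists_cut g
    have h1 := hv.unique (hp.cut_imp (hp.cut_imp ha hb) hb)
    have h2 := hw.unique (hp.cut_imp (hp.cut_imp hb ha) ha)
    have := ha.1
    have := hb.1
    omega
  contra f g := pow_ext fun p hp v w hv hw => by
    obtain ⟨a, ha⟩ := hp.exists_cut f
    obtain ⟨b, hb⟩ := hp.exists_cut g
    have h1 := hv.unique (hp.cut_imp (hp.cut_imp (hp.cut_neg hb) (hp.cut_neg ha))
      (hp.cut_imp ha hb))
    have h2 := hw.unique hp.cut_one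
    have := ha.1
    have := hb.1
    omega

end Pow

/-! ### Divisors, the class `B^{n+1}` and the algebra `M(B,h)` -/

/-- The positive divisors of `n`. -/
abbrev Divs (n : ℕ) : Type := {d : ℕ // d ∈ n.divisors}

namespace Divs

variable {n : ℕ}

theorem pos (d : Divs n) : 0 < d.1 := Nat.pos_of_mem_divisors d.2

theorem mul_div (d : Divs n) : d.1 * (n / d.1) = n :=
  Nat.mul_div_cancel' (Nat.dvd_of_mem_divisors d.2)

theorem div_pos (d : Divs n) : 0 < n / d.1 :=
  Nat.div_pos (Nat.divisor_le d.2) d.pos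

/-- The greatest common divisor, the meet in the lattice of divisors. -/
def gcd (d e : Divs n) : Divs n :=
  ⟨Nat.gcd d.1 e.1, Nat.mem_divisors.2
    ⟨(Nat.gcd_dvd_left _ _).trans (Nat.dvd_of_mem_divisors d.2), (Nat.mem_divisors.1 d.2).2⟩⟩

/-- `n` as a divisor of `n`. -/
def top (n : ℕ) [NeZero n] : Divs n := ⟨n, Nat.mem_divisors_self n (NeZero.ne n)⟩

/-- The index `q (n/d)`, the last one of the `q`-th block determined by `d`. -/
def last (d : Divs n) (q : Idx d.1) : Idx n :=
  ⟨q.1 * (n / d.1), Nat.mul_pos q.2.1 d.div_pos,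
    (Nat.mul_le_mul_right _ q.2.2).trans d.mul_div.le⟩

/-- The index `(q-1)(n/d) + 1`, the first one of the `q`-th block determined by `d`. -/
def first (d : Divs n) (q : Idx d.1) : Idx n :=
  ⟨(q.1 - 1) * (n / d.1) + 1, Nat.le_add_left _ _, by
    have h1 := (d.last q).2.2
    have h2 := d.div_pos
    have h3 := q.2.1
    have h4 : (q.1 - 1) * (n / d.1) + n / d.1 = q.1 * (n / d.1) := by
      conv_rhs => rw [← Nat.sub_add_cancel h3, Nat.add_mul, Nat.one_mul]
    have h5 : q.1 * (n / d.1) ≤ n := h1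
    omega⟩

end Divs

section M

variable {n : ℕ} {B : Type*} [BooleanAlgebra B]

/-- `ξ_{d,q}(f) = f(q (n/d)) → f((q-1)(n/d) + 1)`. -/
def xi (d : Divs n) (q : Idx d.1) (f : Pow n B) : B := f (d.last q) ⇨ f (d.first q)

theorem xi_neg (d : Divs n) (q : Idx d.1) (f : Pow n B) :
    ∃ q' : Idx d.1, xi d q ∼f = xi d q' f := by
  have hq := q.2
  refine ⟨⟨d.1 - q.1 + 1, by omega⟩, ?_⟩
  have e1 : n + 1 - q.1 * (n / d.1) = (d.1 - q.1 + 1 - 1) * (n / d.1) + 1 := by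
    have h1 : (d.1 - q.1) * (n / d.1) + q.1 * (n / d.1) = n := by
      rw [← Nat.add_mul, Nat.sub_add_cancel hq.2, d.mul_div]
    rw [Nat.add_sub_cancel]; omega
  have e2 : n + 1 - ((q.1 - 1) * (n / d.1) + 1) = (d.1 - q.1 + 1) * (n / d.1) := by
    have h1 : (d.1 - q.1 + 1) * (n / d.1) + (q.1 - 1) * (n / d.1) = n := by
      rw [← Nat.add_mul, show d.1 - q.1 + 1 + (q.1 - 1) = d.1 by omega, d.mul_div]
    omega
  change (f ⟨n + 1 - q.1 * (n / d.1), _⟩)ᶜ ⇨ (f ⟨n + 1 - ((q.1 - 1) * (n / d.1) + 1), _⟩)ᶜ =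
    f ⟨(d.1 - q.1 + 1) * (n / d.1), _⟩ ⇨ f ⟨(d.1 - q.1 + 1 - 1) * (n / d.1) + 1, _⟩
  simp only [e1, e2, himp_eq, compl_compl, sup_comm]

theorem xi_imp (d : Divs n) (q : Idx d.1) (f g : Pow n B) {F : PFilter B}
    (hf : ∀ r, xi d r f ∈ F) (hg : ∀ r, xi d r g ∈ F) : xi d q (f ⇝ g) ∈ F := by
  have hq := q.2
  have hm := d.div_pos
  have hdm := d.mul_div
  -- reduction to the individual terms of the meet that defines the right-hand side
  have hfin : ∀ (s : Finset {i // i ∈ Finset.Icc 1 (n - (d.first q).1 + 1)}) (a : B)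
      (u : {i // i ∈ Finset.Icc 1 (n - (d.first q).1 + 1)} → B),
      (∀ i ∈ s, a ⇨ u i ∈ F) → a ⇨ s.inf u ∈ F := by
    intro s a u
    classical
    induction s using Finset.induction_on with
    | empty => intro _; simp
    | insert i s hi ih =>
      intro h
      rw [Finset.inf_insert, himp_inf_distrib]
      exact PFilter.inf_mem (h i (Finset.mem_insert_self _ _))
        (ih fun j hj => h j (Finset.mem_insert_of_mem hj))
  change powImpFun f g (d.last q) ⇨ powImpFun f g (d.first q) ∈ F
  refine hfin _ _ _ ?_
  rintro ⟨r, hr⟩ -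
  have hr' := Finset.mem_Icc.1 hr
  have hq1 : (q.1 - 1) * (n / d.1) + (n / d.1) = q.1 * (n / d.1) := by
    conv_rhs => rw [← Nat.sub_add_cancel hq.1, Nat.add_mul, Nat.one_mul]
  have hqd : q.1 * (n / d.1) + (d.1 - q.1) * (n / d.1) = n := by
    rw [← Nat.add_mul, Nat.add_sub_cancel' hq.2, d.mul_div]
  have hfirst : (d.first q).1 = (q.1 - 1) * (n / d.1) + 1 := rfl
  have hlast : (d.last q).1 = q.1 * (n / d.1) := rfl
  -- the block `t + 1` that contains `r`
  obtain ⟨t, ht1, ht2⟩ : ∃ t, t * (n / d.1) + 1 ≤ r ∧ r ≤ (t + 1) * (n / d.1) := by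
    refine ⟨(r - 1) / (n / d.1), ?_, ?_⟩
    · have := Nat.div_mul_le_self (r - 1) (n / d.1); omega
    · have := Nat.lt_succ_iff.1 (Nat.lt_succ_of_lt (Nat.lt_mul_div_succ (r - 1) hm))
      have h2 := Nat.lt_mul_div_succ (r - 1) hm
      rw [Nat.mul_comm] at h2; omega
  have ht3 : (t + 1) * (n / d.1) = t * (n / d.1) + n / d.1 := by ring
  have htd : t + q.1 ≤ d.1 := by
    by_contra hc
    have h1 : d.1 - q.1 + 1 ≤ t := by omega
    have h2 := Nat.mul_le_mul_right (n / d.1) h1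
    have h3 : (d.1 - q.1 + 1) * (n / d.1) = (d.1 - q.1) * (n / d.1) + n / d.1 := by ring
    omega
  have hE1 := hf ⟨t + 1, by omega⟩
  have hE2 := hg ⟨t + q.1, by omega⟩
  refine PFilter.mem_of_le ?_ (PFilter.inf_mem hE1 hE2)
  have htq : (t + q.1) * (n / d.1) = t * (n / d.1) + q.1 * (n / d.1) := by ring
  have htq1 : (t + q.1 - 1) * (n / d.1) = t * (n / d.1) + (q.1 - 1) * (n / d.1) := by
    rw [Nat.add_sub_assoc hq.1, Nat.add_mul]
  have hle : (t + q.1) * (n / d.1) ≤ n := by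
    have := Nat.mul_le_mul_right (n / d.1) htd
    omega
  have key := le_powImpFun.1 (le_refl (powImpFun f g (d.last q)))
    ⟨t * (n / d.1) + 1, by omega, by omega⟩ ⟨(t + q.1) * (n / d.1), by omega, hle⟩
    (by dsimp only; omega)
  have m1 : f ⟨r, by omega⟩ ≤ f (d.last ⟨t + 1, by omega⟩) := f.monotone (by
    change r ≤ (t + 1) * (n / d.1); omega)
  have m2 : f (d.first ⟨t + 1, by omega⟩) = f ⟨t * (n / d.1) + 1, by omega, by omega⟩ := by
    congr 1
  have m3 : g (d.first ⟨t + q.1, by omega⟩) ≤ g ⟨r + (d.first q).1 - 1, by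
      omega⟩ := g.monotone (by
    change (t + q.1 - 1) * (n / d.1) + 1 ≤ r + (d.first q).1 - 1; omega)
  rw [le_himp_iff, le_himp_iff]
  refine le_trans ?_ m3
  have s1 : xi d ⟨t + 1, by omega⟩ f ⊓ f ⟨r, by omega⟩ ≤ f (d.first ⟨t + 1, by omega⟩) :=
    (inf_le_inf_left _ m1).trans himp_inf_le
  rw [m2] at s1
  rw [le_himp_iff] at key
  have s2 : xi d ⟨t + q.1, by omega⟩ g ⊓ g ⟨(t + q.1) * (n / d.1), by omega, hle⟩ ≤
    g (d.first ⟨t + q.1, by omega⟩) := himp_inf_le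
  refine le_trans (le_inf (inf_le_left.trans (inf_le_left.trans inf_le_right)) ?_) s2
  refine le_trans (le_inf (inf_le_left.trans inf_le_right) ?_) key
  exact le_trans (le_inf (inf_le_left.trans (inf_le_left.trans inf_le_left)) inf_le_right) s1

/-- `M(B,h) = {f ∈ B^{[n]} : ξ_{d,q}(f) ∈ h(d) for all d ∣ n and 1 ≤ q ≤ d}`, as a subalgebra
of `B^{[n]}`. -/
def M (n : ℕ) (B : Type*) [BooleanAlgebra B] (h : Divs n → PFilter B) : Subalg (Pow n B) where
  carrier := {f | ∀ (d : Divs n) (q : Idx d.1), xi d q f ∈ h d}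
  imp_mem hf hg d q := xi_imp d q _ _ (hf d) (hg d)
  neg_mem {f} hf d q := by
    obtain ⟨q', e⟩ := xi_neg d q f
    rw [e]; exact hf d q'
  one_mem d q := by
    change (⊤ : B) ⇨ ⊤ ∈ h d
    simp

/-- `⟨B, h⟩ ∈ B^{n+1}`: `h(n) = {1}` and `h(gcd(d,e)) = h(d) ∨ h(e)` in the lattice of filters. -/
structure IsBPair (n : ℕ) [NeZero n] (B : Type*) [BooleanAlgebra B] (h : Divs n → PFilter B) :
    Prop where
  map_top : (h (Divs.top n) : Set B) = {⊤}
  map_gcd : ∀ d e, IsLUB {h d, h e} (h (d.gcd e))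

/-- `⟨B₁, h₁⟩` and `⟨B₂, h₂⟩` are isomorphic in `B^{n+1}`. -/
def BPairIso {n : ℕ} {B₁ B₂ : Type*} [BooleanAlgebra B₁] [BooleanAlgebra B₂]
    (h₁ : Divs n → PFilter B₁) (h₂ : Divs n → PFilter B₂) : Prop :=
  ∃ φ : B₁ ≃o B₂, ∀ d, φ ⁻¹' (h₂ d : Set B₂) = h₁ d

end M

/-- `h_A(d) = P_d ∩ B(A)`, where `P_d` is the intersection of all prime implicative filters `P`
of `A` with `A/P ⊆ L_{d+1}`. -/
def hA (n : ℕ) (A : Type*) [WajsbergAlgebra A] (d : Divs n) : PFilter (BooleanPart A) :=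
  IsPFilter.toPFilter (F := {b : BooleanPart A |
      ∀ P : ImplFilter A, P.IsPrime → EmbedsInLuk P.Quot d.1 → b.1 ∈ P.carrier}) <| by
    refine IsPFilter.of_def ⟨⊤, fun P _ _ => P.one_mem⟩ ?_ ?_
    · intro x hx y hy
      refine ⟨x ⊓ y, fun P hP hd => ?_, inf_le_left, inf_le_right⟩
      have h1 : Le x.1 (y.1 ⇝ (x ⊓ y).1) := by
        change Le x.1 (y.1 ⇝ wedge x.1 y.1)
        unfold Le
        rw [wedge_eq_odot x.2, ← odot_imp]
        exact le_rfl' _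
      exact P.mp (hy P hP hd) (ImplFilter.mem_of_le h1 (hx P hP hd))
    · intro x y hxy hx P hP hd
      exact ImplFilter.mem_of_le hxy (hx P hP hd)

/-! ### Stone spaces and `(n+1)`-valued Boolean spaces -/

/-- The Stone space `χ(B)`: the set of prime filters of `B`. -/
def StoneSpace (B : Type*) [BooleanAlgebra B] : Type _ := {U : PFilter B // U.IsPrime}

/-- `s(a) = {U ∈ χ(B) : a ∈ U}`. -/
def stoneSet {B : Type*} [BooleanAlgebra B] (a : B) : Set (StoneSpace B) := {U | a ∈ U.1}

/-- The topology with basis the sets `s(a)`. -/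
instance {B : Type*} [BooleanAlgebra B] : TopologicalSpace (StoneSpace B) :=
  TopologicalSpace.generateFrom (Set.range stoneSet)

theorem isClosed_stoneSet {B : Type*} [BooleanAlgebra B] (a : B) :
    IsClosed (stoneSet a : Set (StoneSpace B)) := by
  rw [← isOpen_compl_iff]
  refine TopologicalSpace.isOpen_generateFrom_of_mem ⟨aᶜ, ?_⟩
  ext ⟨U, hU⟩
  change aᶜ ∈ U ↔ a ∉ U
  constructor
  · intro h h'
    obtain ⟨z, hz⟩ := hU.compl_ideal.2
    exact hz (PFilter.mem_of_le (by rw [inf_compl_eq_bot]; exact bot_le) (PFilter.inf_mem h' h))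
  · intro h
    by_contra hc
    obtain ⟨z, hz, h1, h2⟩ := hU.compl_ideal.3 a h aᶜ hc
    have h3 : a ⊔ aᶜ ≤ z := sup_le h1 h2
    rw [sup_compl_eq_top] at h3
    exact hz (PFilter.mem_of_le h3 PFilter.top_mem)

/-- `δ(F) = ⋂ {s(x) : x ∈ F}`, a closed subset of `χ(B)`. -/
def delta {B : Type*} [BooleanAlgebra B] (F : PFilter B) : TopologicalSpace.Closeds (StoneSpace B) :=
  ⟨⋂ x ∈ F, stoneSet x, isClosed_biInter fun x _ => isClosed_stoneSet x⟩

/-- `⟨X, h⟩` is an `(n+1)`-valued Boolean space. -/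
structure IsValuedBooleanSpace (n : ℕ) [NeZero n] (X : Type*) [TopologicalSpace X]
    (h : Divs n → TopologicalSpace.Closeds X) : Prop where
  compact : CompactSpace X
  hausdorff : T2Space X
  totallyDisconnected : TotallyDisconnectedSpace X
  map_gcd : ∀ d e, h (d.gcd e) = h d ⊓ h e
  map_top : h (Divs.top n) = ⊤

/-- `⟨X, h⟩` and `⟨Y, g⟩` are isomorphic. -/
def SpaceIso {n : ℕ} {X Y : Type*} [TopologicalSpace X] [TopologicalSpace Y]
    (h : Divs n → TopologicalSpace.Closeds X) (g : Divs n → TopologicalSpace.Closeds Y) : Prop :=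
  ∃ φ : X ≃ₜ Y, ∀ d, φ ⁻¹' (g d : Set Y) = h d

theorem continuous_neg' {X : Type*} [TopologicalSpace X] {f : X → unitInterval}
    (hf : Continuous f) : Continuous (∼f) :=
  Continuous.subtype_mk (continuous_const.sub (continuous_subtype_val.comp hf)) _

theorem continuous_imp' {X : Type*} [TopologicalSpace X] {f g : X → unitInterval}
    (hf : Continuous f) (hg : Continuous g) : Continuous (f ⇝ g) :=
  Continuous.subtype_mk (continuous_const.min
    ((continuous_const.sub (continuous_subtype_val.comp hf)).add
      (continuous_subtype_val.comp hg))) _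

/-- The algebra of the continuous functions `f : X → L_{n+1}` with `f(h(d)) ⊆ L_{d+1}` for every
divisor `d` of `n`, with the pointwise operations. -/
def Cfun (n : ℕ) [NeZero n] (X : Type*) [TopologicalSpace X]
    (h : Divs n → TopologicalSpace.Closeds X) : Subalg (X → unitInterval) where
  carrier := {f | Continuous f ∧ (∀ x, f x ∈ Luk n) ∧ ∀ d : Divs n, ∀ x ∈ h d, f x ∈ Luk d.1}
  imp_mem hf hg := ⟨continuous_imp' hf.1 hg.1,
    fun x => imp_mem_Luk (NeZero.pos n) (hf.2.1 x) (hg.2.1 x),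
    fun d x hx => imp_mem_Luk d.pos (hf.2.2 d x hx) (hg.2.2 d x hx)⟩
  neg_mem hf := ⟨continuous_neg' hf.1, fun x => neg_mem_Luk (NeZero.pos n) (hf.2.1 x),
    fun d x hx => neg_mem_Luk d.pos (hf.2.2 d x hx)⟩
  one_mem := ⟨continuous_const, fun _ => one_mem_Luk (NeZero.pos n), fun d _ _ => one_mem_Luk d.pos⟩

/-- `g̃ : χ(B) → L_{n+1}` is the function associated with `g ∈ B^{[n]}`: it takes the value `1` on
`S₁`, the value `k/n` on `S_{n-k+1} ∖ S_{n-k}` for `1 ≤ k ≤ n-1`, and the value `0` outside `S_n`,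
where `S_i = s(g(i))`. -/
def IsTilde {n : ℕ} {B : Type*} [BooleanAlgebra B] (g : Pow n B)
    (gt : StoneSpace B → unitInterval) : Prop :=
  ∀ U : StoneSpace B,
    (∀ i : Idx n, i.1 = 1 → U ∈ stoneSet (g i) → (gt U : ℝ) = 1) ∧
    (∀ (k : ℕ) (i j : Idx n), 1 ≤ k → k ≤ n - 1 → i.1 = n - k + 1 → j.1 = n - k →
      U ∈ stoneSet (g i) \ stoneSet (g j) → (gt U : ℝ) = (k : ℝ) / n) ∧
    (∀ i : Idx n, i.1 = n → U ∉ stoneSet (g i) → (gt U : ℝ) = 0)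

/-! ### The statements that are compared -/

/-- The map `x ↦ (i ↦ σ_i(x))` is an isomorphism from `A` onto `M(B(A), h_A)`. -/
def SigmaIso (n : ℕ) (A : Type*) [WajsbergAlgebra A] : Prop :=
  ∃ φ : Iso A (M n (BooleanPart A) (hA n A)).Elem,
    ∀ (x : A) (i : Idx n), ((φ.toFun x).1 i).1 = sigma n i.1 x

/-- `⟨X, h⟩` is an `(n+1)`-valued Boolean space that represents `A`. -/
def Represents (n : ℕ) [NeZero n] (A : Type*) [WajsbergAlgebra A] (X : Type*) [TopologicalSpace X]
    (h : Divs n → TopologicalSpace.Closeds X) : Prop :=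
  IsValuedBooleanSpace n X h ∧ Nonempty (Iso A (Cfun n X h).Elem)

/-- The `(n+1)`-valued Boolean spaces that represent `A` exist, are all isomorphic to each other,
and are homeomorphic to the Stone space of `B(A)`. -/
def UniquelyRepresentable (n : ℕ) [NeZero n] (A : Type u) [WajsbergAlgebra A] : Prop :=
  (∃ (X : Type u) (_ : TopologicalSpace X) (h : Divs n → TopologicalSpace.Closeds X),
    Represents n A X h) ∧
  (∀ (X : Type v) (Y : Type w) [TopologicalSpace X] [TopologicalSpace Y]
    (h : Divs n → TopologicalSpace.Closeds X) (g : Divs n → TopologicalSpace.Closeds Y),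
    Represents n A X h → Represents n A Y g → SpaceIso h g) ∧
  (∀ (X : Type v) [TopologicalSpace X] (h : Divs n → TopologicalSpace.Closeds X),
    Represents n A X h → Nonempty (X ≃ₜ StoneSpace (BooleanPart A)))

end WajsbergAlgebra

namespace WajsbergAlgebra

/-! ### The operations of `[0,1]` -/

theorem coe_imp (x y : unitInterval) : ((x ⇝ y : unitInterval) : ℝ) = min 1 (1 - (x : ℝ) + y) := rfl

theorem coe_neg (x : unitInterval) : ((∼x : unitInterval) : ℝ) = 1 - (x : ℝ) := rfl

theorem coe_one : ((one : unitInterval) : ℝ) = 1 := rfl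

theorem coe_zero : ((zero : unitInterval) : ℝ) = 0 := sub_self _

theorem coe_vee (x y : unitInterval) : ((vee x y : unitInterval) : ℝ) = max (x : ℝ) y := by
  have := x.2.2; have := y.2.2
  simp only [vee, coe_imp, min_def, max_def]; split_ifs <;> linarith

theorem coe_wedge (x y : unitInterval) : ((wedge x y : unitInterval) : ℝ) = min (x : ℝ) y := by
  simp only [wedge, coe_vee, coe_neg, min_def, max_def]; split_ifs <;> linarith

theorem coe_oplus (x y : unitInterval) : ((oplus x y : unitInterval) : ℝ) = min 1 ((x : ℝ) + y) := by
  simp only [oplus, coe_imp, coe_neg]; congr 1; ring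

theorem coe_odot (x y : unitInterval) :
    ((odot x y : unitInterval) : ℝ) = max 0 ((x : ℝ) + y - 1) := by
  simp only [odot, coe_imp, coe_neg, min_def, max_def]; split_ifs <;> linarith

theorem zero_ne_one_unitInterval : (zero : unitInterval) ≠ one := by
  intro h
  have := congrArg Subtype.val h
  rw [coe_zero, coe_one] at this
  exact zero_ne_one this

theorem eq_zero_or_one_of_idem {x : unitInterval} (h : odot x x = x) : x = zero ∨ x = one := by
  have h1 := congrArg Subtype.val h
  rw [coe_odot] at h1
  rcases le_total ((x : ℝ) + x - 1) 0 with h2 | h2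
  · left; rw [max_eq_left h2] at h1; exact Subtype.ext (by rw [coe_zero, ← h1])
  · right; rw [max_eq_right h2] at h1; exact Subtype.ext (by rw [coe_one]; linarith)

theorem mem_Luk_iff {d : ℕ} (hd : 0 < d) {x : unitInterval} :
    x ∈ Luk d ↔ ∃ z : ℤ, (d : ℝ) * x = z := by
  have hd' : (0 : ℝ) < d := by exact_mod_cast hd
  constructor
  · rintro ⟨k, -, e⟩
    exact ⟨k, by rw [e]; push_cast; field_simp⟩
  · rintro ⟨z, e⟩
    have h0 : (0 : ℝ) ≤ z := by rw [← e]; exact mul_nonneg hd'.le x.2.1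
    have h1 : (z : ℝ) ≤ d := by rw [← e]; exact mul_le_of_le_one_right hd'.le x.2.2
    have h0' : 0 ≤ z := by exact_mod_cast h0
    have h1' : z ≤ d := by exact_mod_cast h1
    lift z to ℕ using h0'
    refine ⟨z, by exact_mod_cast h1', ?_⟩
    rw [eq_div_iff hd'.ne', mul_comm, e]; simp

theorem Luk_mono {d e : ℕ} (hd : 0 < d) (he : 0 < e) (h : d ∣ e) : Luk d ⊆ Luk e := by
  intro x hx
  obtain ⟨z, hz⟩ := (mem_Luk_iff hd).1 hx
  obtain ⟨c, rfl⟩ := h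
  exact (mem_Luk_iff he).2 ⟨c * z, by push_cast; rw [← hz]; ring⟩

theorem mem_Luk_gcd {d e : ℕ} (hd : 0 < d) (he : 0 < e) {x : unitInterval} (hx : x ∈ Luk d)
    (hx' : x ∈ Luk e) : x ∈ Luk (Nat.gcd d e) := by
  obtain ⟨z, hz⟩ := (mem_Luk_iff hd).1 hx
  obtain ⟨y, hy⟩ := (mem_Luk_iff he).1 hx'
  refine (mem_Luk_iff (Nat.gcd_pos_of_pos_left _ hd)).2 ⟨d.gcdA e * z + d.gcdB e * y, ?_⟩
  have h := congrArg (Int.cast : ℤ → ℝ) (Nat.gcd_eq_gcd_ab d e)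
  push_cast at h ⊢
  rw [h, ← hz, ← hy]; ring

theorem finite_Luk (d : ℕ) : (Luk d).Finite := by
  refine Set.Finite.of_finite_image (f := Subtype.val) ?_ Subtype.val_injective.injOn
  refine ((Set.finite_Iic d).image fun k : ℕ => (k : ℝ) / d).subset ?_
  rintro _ ⟨x, ⟨k, hk, e⟩, rfl⟩
  exact ⟨k, hk, e.symm⟩

theorem sigma_eq_ite {n i j : ℕ} (hn : 0 < n) (x : unitInterval) (hx : (x : ℝ) = j / n) :
    sigma n i x = if n < i + j then one else zero := by
  refine Subtype.ext ?_
  rw [sigma_Luk hn x hx]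
  split_ifs
  · exact coe_one.symm
  · exact coe_zero.symm

/-! ### Homomorphisms -/

namespace Hom

variable {A A' A'' : Type*} [WajsbergAlgebra A] [WajsbergAlgebra A'] [WajsbergAlgebra A'']

/-- The composition of two homomorphisms. -/
def comp (g : Hom A' A'') (f : Hom A A') : Hom A A'' where
  toFun x := g.toFun (f.toFun x)
  map_imp x y := by rw [f.map_imp, g.map_imp]
  map_neg x := by rw [f.map_neg, g.map_neg]
  map_one := by rw [f.map_one, g.map_one]

variable (g : Hom A A')

theorem map_zero : g.toFun zero = zero := by
  unfold zero; rw [g.map_neg, g.map_one]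

theorem map_odot (x y : A) : g.toFun (odot x y) = odot (g.toFun x) (g.toFun y) := by
  simp only [odot, g.map_neg, g.map_imp]

theorem map_oplus (x y : A) : g.toFun (oplus x y) = oplus (g.toFun x) (g.toFun y) := by
  simp only [oplus, g.map_neg, g.map_imp]

theorem map_vee (x y : A) : g.toFun (vee x y) = vee (g.toFun x) (g.toFun y) := by
  simp only [vee, g.map_imp]

theorem map_wedge (x y : A) : g.toFun (wedge x y) = wedge (g.toFun x) (g.toFun y) := by
  simp only [wedge, g.map_neg, g.map_vee]

theorem map_lin (a : ℕ) (b : ℤ) (x : A) : g.toFun (lin a b x) = lin a b (g.toFun x) := by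
  induction a generalizing b with
  | zero => unfold lin; split_ifs; exacts [g.map_one, g.map_zero]
  | succ a ih => unfold lin; rw [g.map_odot, g.map_oplus, ih, ih]

theorem map_sigma (n i : ℕ) (x : A) : g.toFun (sigma n i x) = sigma n i (g.toFun x) :=
  g.map_lin _ _ _

theorem map_eval (t : Term) (v : ℕ → A) : g.toFun (t.eval v) = t.eval fun i => g.toFun (v i) := by
  induction t with
  | var i => rfl
  | imp s t hs ht => simp only [Term.eval, g.map_imp, hs, ht]
  | neg t ht => simp only [Term.eval, g.map_neg, ht]
  | one => exact g.map_one

theorem injective_of_ker (h : ∀ x, g.toFun x = one → x = one) : Function.Injective g.toFun := by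
  intro x y e
  refine Le.antisymm (h _ ?_) (h _ ?_)
  · rw [g.map_imp, e]; exact le_rfl' _
  · rw [g.map_imp, e]; exact le_rfl' _

/-- The implicative filter `g⁻¹(1)`. -/
def ker : ImplFilter A where
  carrier := {x | g.toFun x = one}
  one_mem := g.map_one
  mp {a b} ha hab := by
    have hab' : g.toFun (a ⇝ b) = one := hab
    rwa [g.map_imp, show g.toFun a = one from ha, one_imp] at hab'

theorem isPrime_ker (g : Hom A unitInterval) : g.ker.IsPrime := by
  constructor
  · intro h
    have h0 : zero ∈ g.ker.carrier := by rw [h]; trivial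
    have h1 : g.toFun zero = one := h0
    rw [g.map_zero] at h1
    exact zero_ne_one_unitInterval h1
  · intro x y h
    have h1 : g.toFun (vee x y) = one := h
    rw [g.map_vee, Subtype.ext_iff, coe_vee] at h1
    rcases max_choice (g.toFun x : ℝ) (g.toFun y) with e | e
    · exact Or.inl (Subtype.ext (e.symm.trans h1))
    · exact Or.inr (Subtype.ext (e.symm.trans h1))

/-- The homomorphism induced on the quotient by the kernel. -/
def kerLift : Hom g.ker.Quot A' where
  toFun := Quotient.lift g.toFun fun x y h => by
    have h1 : g.toFun (x ⇝ y) = one := h.1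
    have h2 : g.toFun (y ⇝ x) = one := h.2
    rw [g.map_imp] at h1 h2
    exact Le.antisymm h1 h2
  map_imp := by rintro ⟨x⟩ ⟨y⟩; exact g.map_imp x y
  map_neg := by rintro ⟨x⟩; exact g.map_neg x
  map_one := g.map_one

theorem embedsInLuk_ker (g : Hom A unitInterval) {d : ℕ} (hg : ∀ x, g.toFun x ∈ Luk d) :
    EmbedsInLuk g.ker.Quot d := by
  refine ⟨g.kerLift, g.kerLift.injective_of_ker ?_, ?_⟩
  · rintro ⟨x⟩ hx
    have hx' : g.toFun x = one := hx
    refine Quotient.sound ⟨?_, ?_⟩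
    · rw [show x ⇝ one = (one : A) from le_one x]; exact g.map_one
    · rw [one_imp]; exact hx'
  · rintro ⟨x⟩; exact hg x

end Hom

/-- The projection onto the quotient by an implicative filter. -/
def ImplFilter.proj {A : Type*} [WajsbergAlgebra A] (F : ImplFilter A) : Hom A F.Quot where
  toFun := Quotient.mk F.con
  map_imp _ _ := rfl
  map_neg _ := rfl
  map_one := rfl

theorem ImplFilter.proj_eq_one {A : Type*} [WajsbergAlgebra A] {F : ImplFilter A} {x : A}
    (h : F.proj.toFun x = one) : x ∈ F.carrier := by
  have h1 := (Quotient.exact h : F.con x one).2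
  rwa [one_imp] at h1

/-- The inclusion of a subalgebra. -/
def Subalg.incl {A : Type*} [WajsbergAlgebra A] (S : Subalg A) : Hom S.Elem A where
  toFun x := x.1
  map_imp _ _ := rfl
  map_neg _ := rfl
  map_one := rfl

/-- The evaluation at a point. -/
def evalHom {X : Type*} (A : Type*) [WajsbergAlgebra A] (x : X) : Hom (X → A) A where
  toFun f := f x
  map_imp _ _ := rfl
  map_neg _ := rfl
  map_one := rfl

namespace Iso

variable {A A' A'' : Type*} [WajsbergAlgebra A] [WajsbergAlgebra A'] [WajsbergAlgebra A'']

/-- An isomorphism as a homomorphism. -/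
def hom (φ : Iso A A') : Hom A A' where
  toFun := φ.toFun
  map_imp := φ.map_imp
  map_neg := φ.map_neg
  map_one := φ.map_one

/-- The inverse isomorphism. -/
def symm (φ : Iso A A') : Iso A' A where
  toEquiv := φ.toEquiv.symm
  map_imp x y := φ.toEquiv.injective (by
    have := φ.map_imp (φ.toEquiv.symm x) (φ.toEquiv.symm y)
    simp only [Equiv.toFun_as_coe, Equiv.apply_symm_apply] at this ⊢
    exact this.symm)
  map_neg x := φ.toEquiv.injective (by
    have := φ.map_neg (φ.toEquiv.symm x)
    simp only [Equiv.toFun_as_coe, Equiv.apply_symm_apply] at this ⊢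
    exact this.symm)
  map_one := φ.toEquiv.injective (by
    have := φ.map_one
    simp only [Equiv.toFun_as_coe, Equiv.apply_symm_apply] at this ⊢
    exact this.symm)

/-- The composition of two isomorphisms. -/
def trans (φ : Iso A A') (ψ : Iso A' A'') : Iso A A'' where
  toEquiv := φ.toEquiv.trans ψ.toEquiv
  map_imp := (ψ.hom.comp φ.hom).map_imp
  map_neg := (ψ.hom.comp φ.hom).map_neg
  map_one := (ψ.hom.comp φ.hom).map_one

/-- A bijective homomorphism is an isomorphism. -/
noncomputable def ofBijective (g : Hom A A') (hg : Function.Bijective g.toFun) : Iso A A' where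
  toEquiv := Equiv.ofBijective g.toFun hg
  map_imp := g.map_imp
  map_neg := g.map_neg
  map_one := g.map_one

end Iso

/-! ### `h_A` in terms of homomorphisms -/

theorem mem_hA_iff {n : ℕ} {A : Type*} [WajsbergAlgebra A] {d : Divs n} {b : BooleanPart A} :
    b ∈ hA n A d ↔
      ∀ g : Hom A unitInterval, (∀ x, g.toFun x ∈ Luk d.1) → g.toFun b.1 = one := by
  constructor
  · intro h g hg
    exact h g.ker g.isPrime_ker (g.embedsInLuk_ker hg)
  · rintro h P - ⟨g, hg, hd⟩
    refine P.proj_eq_one (hg ?_)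
    rw [g.map_one]
    exact h (g.comp P.proj) fun x => hd _

theorem isValued_of_separating {n : ℕ} {A : Type*} [WajsbergAlgebra A]
    (h : ∀ x y : A, (∀ g : Hom A unitInterval, (∀ z, g.toFun z ∈ Luk n) → g.toFun x = g.toFun y) →
      x = y) : IsValued n A := by
  intro s t hst v
  refine h _ _ fun g hg => ?_
  rw [g.map_eval, g.map_eval]
  exact hst _ fun i => hg _

/-! ### Identities for the operators `σ_i` -/

namespace Term

/-- The term of `lin`. -/
def lin : ℕ → ℤ → Term → Term
  | 0, b, _ => if b < 0 then one else neg one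
  | a + 1, b, t => neg (imp (imp (neg (lin a b t)) t) (neg (lin a (b - 1) t)))

/-- The term of `σ_i`. -/
def sigma (n i : ℕ) (t : Term) : Term := lin n (n - i) t

variable {A : Type*} [WajsbergAlgebra A]

theorem eval_lin (v : ℕ → A) (a : ℕ) (b : ℤ) (t : Term) :
    (lin a b t).eval v = WajsbergAlgebra.lin a b (t.eval v) := by
  induction a generalizing b with
  | zero => unfold lin WajsbergAlgebra.lin; split_ifs <;> rfl
  | succ a ih => simp only [lin, eval, WajsbergAlgebra.lin, ih, odot, oplus]

theorem eval_sigma (v : ℕ → A) (n i : ℕ) (t : Term) :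
    (sigma n i t).eval v = WajsbergAlgebra.sigma n i (t.eval v) :=
  eval_lin v _ _ t

end Term

theorem imp_Luk {n j k : ℕ} (hn : 0 < n) {x y : unitInterval} (hj : j ≤ n)
    (hx : (x : ℝ) = j / n) (hy : (y : ℝ) = k / n) :
    ((x ⇝ y : unitInterval) : ℝ) = ((n - (j - k) : ℕ) : ℝ) / n := by
  have hn' : (0 : ℝ) < n := by exact_mod_cast hn
  rw [coe_imp, hx, hy]
  rcases le_total j k with h | h
  · rw [Nat.sub_eq_zero_of_le h, Nat.sub_zero, div_self hn'.ne', min_eq_left]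
    have : (j : ℝ) / n ≤ k / n := by gcongr
    linarith
  · have : (k : ℝ) / n ≤ j / n := by gcongr
    rw [min_eq_right (by linarith), Nat.cast_sub (by omega), Nat.cast_sub h]
    field_simp
    ring

theorem neg_Luk {n j : ℕ} (hn : 0 < n) {x : unitInterval} (hj : j ≤ n) (hx : (x : ℝ) = j / n) :
    ((∼x : unitInterval) : ℝ) = ((n - j : ℕ) : ℝ) / n := by
  rw [coe_neg, hx, Nat.cast_sub hj]
  field_simp

namespace IsValued

variable {n : ℕ} [NeZero n] {A : Type*} [WajsbergAlgebra A] (hA : IsValued n A)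
include hA

theorem sigma_idem (i : ℕ) (x : A) : odot (sigma n i x) (sigma n i x) = sigma n i x := by
  have h := hA (.neg (.imp (.sigma n i (.var 0)) (.neg (.sigma n i (.var 0)))))
    (.sigma n i (.var 0)) ?_ (fun _ => x)
  · simpa only [Term.eval, Term.eval_sigma, odot] using h
  · intro v hv
    obtain ⟨j, hj, e⟩ := hv 0
    simp only [Term.eval, Term.eval_sigma, sigma_eq_ite (NeZero.pos n) _ e]
    split_ifs
    · exact one_odot_one
    · exact neg_idem one_odot_one

theorem sigma_le {i j : ℕ} (hij : i ≤ j) (x : A) : Le (sigma n i x) (sigma n j x) := by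
  have h := hA (.imp (.sigma n i (.var 0)) (.sigma n j (.var 0))) .one ?_ (fun _ => x)
  · simpa only [Term.eval, Term.eval_sigma, Le, zero] using h
  · intro v hv
    obtain ⟨l, hl, e⟩ := hv 0
    simp only [Term.eval, Term.eval_sigma, sigma_eq_ite (NeZero.pos n) _ e]
    split_ifs
    · exact le_one _
    · omega
    · exact le_one _
    · exact zero_le' _

theorem sigma_neg {k : ℕ} (hk : k ≤ n + 1) (x : A) : sigma n k ∼x = ∼(sigma n (n + 1 - k) x) := by
  have h := hA (.sigma n k (.neg (.var 0))) (.neg (.sigma n (n + 1 - k) (.var 0))) ?_ (fun _ => x)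
  · simpa only [Term.eval, Term.eval_sigma, Le, zero] using h
  · intro v hv
    obtain ⟨l, hl, e⟩ := hv 0
    simp only [Term.eval, Term.eval_sigma, sigma_eq_ite (NeZero.pos n) _ e,
      sigma_eq_ite (NeZero.pos n) _ (neg_Luk (NeZero.pos n) hl e)]
    split_ifs
    · omega
    · exact (neg_neg' one).symm
    · rfl
    · omega

theorem sigma_one {k : ℕ} (hk : 0 < k) : sigma n k (one : A) = one := by
  have h := hA (.sigma n k .one) .one ?_ (fun _ => one)
  · simpa only [Term.eval, Term.eval_sigma, Le, zero] using h
  · intro v hv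
    simp only [Term.eval, Term.eval_sigma]
    rw [sigma_eq_ite (j := n) (NeZero.pos n), if_pos (by omega)]
    rw [coe_one, div_self (by exact_mod_cast NeZero.ne n)]

theorem sigma_one_le (x : A) : Le (sigma n 1 x) x := by
  have h := hA (.imp (.sigma n 1 (.var 0)) (.var 0)) .one ?_ (fun _ => x)
  · simpa only [Term.eval, Term.eval_sigma, Le, zero] using h
  · intro v hv
    obtain ⟨l, hl, e⟩ := hv 0
    simp only [Term.eval, Term.eval_sigma, sigma_eq_ite (NeZero.pos n) _ e]
    split_ifs
    · have : v 0 = one := Subtype.ext (by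
        rw [e, coe_one, show l = n by omega, div_self (by exact_mod_cast NeZero.ne n)])
      rw [this]; exact le_one _
    · exact zero_le' _

theorem sigma_zero (x : A) : sigma n 0 x = zero := by
  have h := hA (.sigma n 0 (.var 0)) (.neg .one) ?_ (fun _ => x)
  · simpa only [Term.eval, Term.eval_sigma, Le, zero] using h
  · intro v hv
    obtain ⟨l, hl, e⟩ := hv 0
    simp only [Term.eval, Term.eval_sigma, sigma_eq_ite (NeZero.pos n) _ e]
    rw [if_neg (by omega)]; rfl

theorem sigma_succ (x : A) : sigma n (n + 1) x = one := by
  have h := hA (.sigma n (n + 1) (.var 0)) .one ?_ (fun _ => x)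
  · simpa only [Term.eval, Term.eval_sigma, Le, zero] using h
  · intro v hv
    obtain ⟨l, hl, e⟩ := hv 0
    simp only [Term.eval, Term.eval_sigma, sigma_eq_ite (NeZero.pos n) _ e]
    rw [if_pos (by omega)]

theorem sigma_imp_le {i j k : ℕ} (h : j + 1 = i + k) (x y : A) :
    Le (sigma n k (x ⇝ y)) (sigma n i x ⇝ sigma n j y) := by
  have h := hA (.imp (.sigma n k (.imp (.var 0) (.var 1)))
    (.imp (.sigma n i (.var 0)) (.sigma n j (.var 1)))) .one ?_ (fun i => if i = 0 then x else y)
  · simpa only [Term.eval, Term.eval_sigma, if_true, one_ne_zero, if_false, Le] using h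
  · intro v hv
    obtain ⟨a, ha, e⟩ := hv 0
    obtain ⟨b, hb, e'⟩ := hv 1
    simp only [Term.eval, Term.eval_sigma, sigma_eq_ite (NeZero.pos n) _ e,
      sigma_eq_ite (NeZero.pos n) _ e',
      sigma_eq_ite (NeZero.pos n) _ (imp_Luk (NeZero.pos n) ha e e')]
    split_ifs
    all_goals first
      | omega
      | exact zero_le' _
      | (rw [one_imp]; exact le_one _)
      | (rw [show zero ⇝ _ = (one : unitInterval) from zero_le' _]; exact le_one _)

theorem le_sigma_imp {v w k : ℕ} (h : w + 1 ≤ v + k) (hk : 0 < k) (x y : A) :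
    Le ∼(sigma n v x) (sigma n (w + 1) y ⇝ sigma n k (x ⇝ y)) := by
  have h := hA (.imp (.neg (.sigma n v (.var 0))) (.imp (.sigma n (w + 1) (.var 1))
    (.sigma n k (.imp (.var 0) (.var 1))))) .one ?_ (fun i => if i = 0 then x else y)
  · simpa only [Term.eval, Term.eval_sigma, if_true, one_ne_zero, if_false, Le] using h
  · intro v hv
    obtain ⟨a, ha, e⟩ := hv 0
    obtain ⟨b, hb, e'⟩ := hv 1
    simp only [Term.eval, Term.eval_sigma, sigma_eq_ite (NeZero.pos n) _ e,
      sigma_eq_ite (NeZero.pos n) _ e',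
      sigma_eq_ite (NeZero.pos n) _ (imp_Luk (NeZero.pos n) ha e e')]
    split_ifs
    all_goals first
      | omega
      | exact zero_le' _
      | (rw [one_imp]; exact le_one _)
      | (rw [show zero ⇝ _ = (one : unitInterval) from zero_le' _]; exact le_one _)

end IsValued


/-! ### Points of Boolean algebras -/

section Points

variable {B : Type*} [BooleanAlgebra B]

theorem IsPt.not_bot {p : B → Prop} (hp : IsPt p) : ¬p ⊥ := by
  rw [← compl_top, hp.compl, not_not]; exact hp.top

theorem IsPt.sup {p : B → Prop} (hp : IsPt p) (a b : B) : p (a ⊔ b) ↔ p a ∨ p b := by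
  rw [← compl_compl (a ⊔ b), compl_sup, hp.compl, hp.inf, hp.compl, hp.compl]; tauto

theorem exists_pt_of_disjoint {F : PFilter B} {I : Ideal B} (h : Disjoint (F : Set B) I) :
    ∃ p : B → Prop, IsPt p ∧ (∀ a ∈ F, p a) ∧ ∀ a ∈ I, ¬p a := by
  obtain ⟨J, hJ, hI, hF⟩ := DistribLattice.prime_ideal_of_disjoint_filter_ideal h
  have hd : ∀ a, ¬(a ∈ J ∧ aᶜ ∈ J) := fun a ha => hJ.1.top_notMem (by
    have := Order.Ideal.sup_mem ha.1 ha.2; rwa [sup_compl_eq_top] at this)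
  refine ⟨fun x => x ∉ J, ⟨fun x y => ?_, fun x => ?_, hJ.1.top_notMem⟩,
    fun a ha => Set.disjoint_left.1 hF ha, fun a ha hn => hn (hI ha)⟩
  · have h1 : x ⊓ y ∈ J ↔ x ∈ J ∨ y ∈ J :=
      ⟨hJ.mem_or_mem, fun h => h.elim (J.lower inf_le_left) (J.lower inf_le_right)⟩
    rw [h1, not_or]
  · have h1 := hd x
    have h2 : x ∈ J ∨ xᶜ ∈ J := hJ.mem_or_compl_mem
    tauto

/-- The points of `χ(B)` are Boolean homomorphisms into the truth values. -/
theorem StoneSpace.isPt (U : StoneSpace B) : IsPt (fun b => b ∈ U.1) where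
  inf a b := ⟨fun h => ⟨PFilter.mem_of_le inf_le_left h, PFilter.mem_of_le inf_le_right h⟩,
    fun h => PFilter.inf_mem h.1 h.2⟩
  compl a := by
    have hU := U.2.compl_ideal
    constructor
    · intro h h'
      obtain ⟨z, hz⟩ := hU.2
      exact hz (PFilter.mem_of_le (by rw [inf_compl_eq_bot]; exact bot_le) (PFilter.inf_mem h' h))
    · intro h
      by_contra hc
      obtain ⟨z, hz, h1, h2⟩ := hU.3 a h aᶜ hc
      have h3 : a ⊔ aᶜ ≤ z := sup_le h1 h2
      rw [sup_compl_eq_top] at h3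
      exact hz (PFilter.mem_of_le h3 PFilter.top_mem)
  top := PFilter.top_mem

/-- The prime filter of a Boolean homomorphism into the truth values. -/
def IsPt.toStone {p : B → Prop} (hp : IsPt p) : StoneSpace B :=
  ⟨(IsPFilter.of_def ⟨⊤, hp.top⟩
      (fun x hx y hy => ⟨x ⊓ y, (hp.inf x y).2 ⟨hx, hy⟩, inf_le_left, inf_le_right⟩)
      (fun h hx => hp.mono h hx) : IsPFilter {b | p b}).toPFilter,
    ⟨fun _ _ h hy hx => hy (hp.mono h hx), ⟨⊥, hp.not_bot⟩, fun x hx y hy =>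
      ⟨x ⊔ y, fun h => ((hp.sup x y).1 h).elim hx hy, le_sup_left, le_sup_right⟩⟩⟩

theorem exists_stone_of_notMem {F : PFilter B} {b : B} (hb : b ∉ F) :
    ∃ U : StoneSpace B, (∀ a ∈ F, a ∈ U.1) ∧ b ∉ U.1 := by
  obtain ⟨p, hp, h1, h2⟩ := exists_pt_of_disjoint (F := F) (I := Ideal.principal b)
    (Set.disjoint_left.2 fun x hx hx' => hb (PFilter.mem_of_le (Ideal.mem_principal.1 hx') hx))
  exact ⟨hp.toStone, h1, h2 b (Ideal.mem_principal.2 le_rfl)⟩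

theorem mem_delta {F : PFilter B} {U : StoneSpace B} : U ∈ delta F ↔ F ≤ U.1 := by
  change U ∈ ⋂ x ∈ F, stoneSet x ↔ _
  rw [Set.mem_iInter₂]; rfl

theorem mem_iff_forall_stone {F : PFilter B} {b : B} :
    b ∈ F ↔ ∀ U ∈ delta F, b ∈ U.1 := by
  constructor
  · exact fun h U hU => mem_delta.1 hU h
  · intro h
    by_contra hb
    obtain ⟨U, h1, h2⟩ := exists_stone_of_notMem hb
    exact h2 (h U (mem_delta.2 h1))

theorem StoneSpace.ext {U V : StoneSpace B} (h : ∀ b, b ∈ U.1 → b ∈ V.1) : U = V := by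
  refine Subtype.ext (le_antisymm h fun b hb => ?_)
  by_contra hc
  exact (V.isPt.compl b).1 (h _ ((U.isPt.compl b).2 hc)) hb

end Points

/-! ### The values of a monotone function at the points -/

section Cut

variable {n : ℕ} {B : Type*} [BooleanAlgebra B]

/-- The cut of `f` at a point. -/
noncomputable def IsPt.cut {p : B → Prop} (hp : IsPt p) (f : Pow n B) : ℕ :=
  (hp.exists_cut f).choose

theorem IsPt.isCut {p : B → Prop} (hp : IsPt p) (f : Pow n B) : IsCut p f (hp.cut f) :=
  (hp.exists_cut f).choose_spec

theorem IsPt.cut_eq {p : B → Prop} (hp : IsPt p) {f : Pow n B} {v : ℕ} (h : IsCut p f v) :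
    hp.cut f = v :=
  (hp.isCut f).unique h

/-- The evaluation `B^{[n]} → L_{n+1}` at a point. -/
noncomputable def IsPt.evalPow [NeZero n] {p : B → Prop} (hp : IsPt p) :
    Hom (Pow n B) unitInterval where
  toFun f := ⟨((n - hp.cut f : ℕ) : ℝ) / n, by positivity,
    div_le_one_of_le₀ (by exact_mod_cast Nat.sub_le _ _) (by positivity)⟩
  map_imp f g := Subtype.ext (by
    have h1 := (hp.isCut f).1
    have h2 := (hp.isCut g).1
    have e : hp.cut (f ⇝ g) = hp.cut g - hp.cut f :=
      hp.cut_eq (hp.cut_imp (hp.isCut f) (hp.isCut g))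
    rw [imp_Luk (NeZero.pos n) (Nat.sub_le _ _) rfl rfl]
    dsimp only
    rw [e]
    congr 2
    omega)
  map_neg f := Subtype.ext (by
    have h1 := (hp.isCut f).1
    have e : hp.cut ∼f = n - hp.cut f := hp.cut_eq (hp.cut_neg (hp.isCut f))
    rw [neg_Luk (NeZero.pos n) (Nat.sub_le _ _) rfl]
    dsimp only
    rw [e])
  map_one := Subtype.ext (by
    have e : hp.cut (one : Pow n B) = 0 := hp.cut_eq hp.cut_one
    dsimp only
    rw [e, Nat.sub_zero, div_self (by exact_mod_cast NeZero.ne n)]; rfl)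

variable [NeZero n]

theorem IsPt.coe_evalPow {p : B → Prop} (hp : IsPt p) (f : Pow n B) :
    (hp.evalPow.toFun f : ℝ) = ((n - hp.cut f : ℕ) : ℝ) / n := rfl

theorem IsPt.coe_evalPow_of_isCut {p : B → Prop} (hp : IsPt p) {f : Pow n B} {v : ℕ}
    (h : IsCut p f v) : (hp.evalPow.toFun f : ℝ) = ((n - v : ℕ) : ℝ) / n := by
  rw [hp.coe_evalPow, hp.cut_eq h]

theorem IsPt.evalPow_mem {p : B → Prop} (hp : IsPt p) (f : Pow n B) :
    hp.evalPow.toFun f ∈ Luk n :=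
  ⟨_, Nat.sub_le _ _, hp.coe_evalPow f⟩

theorem IsPt.evalPow_eq_iff {p : B → Prop} (hp : IsPt p) {f g : Pow n B} :
    hp.evalPow.toFun f = hp.evalPow.toFun g ↔ ∀ i, p (f i) ↔ p (g i) := by
  have hn : (n : ℝ) ≠ 0 := by exact_mod_cast NeZero.ne n
  have hf := hp.isCut f
  have hg := hp.isCut g
  constructor
  · intro h i
    rw [Subtype.ext_iff, hp.coe_evalPow, hp.coe_evalPow, div_left_inj' hn, Nat.cast_inj] at h
    rw [hf.2, hg.2]
    have := hf.1
    have := hg.1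
    omega
  · intro h
    have : IsCut p f (hp.cut g) := ⟨hg.1, fun i => (h i).trans (hg.2 i)⟩
    rw [Subtype.ext_iff, hp.coe_evalPow_of_isCut this, hp.coe_evalPow]

/-- The elements of `B^{[n]}` are determined by their values at the points. -/
theorem pow_ext_eval {f g : Pow n B}
    (h : ∀ p : B → Prop, ∀ hp : IsPt p, hp.evalPow.toFun f = hp.evalPow.toFun g) : f = g := by
  refine pow_ext fun p hp v w hv hw => hv.unique ⟨hw.1, fun i => ?_⟩
  rw [hp.evalPow_eq_iff.1 (h p hp) i, hw.2]

theorem IsPt.evalPow_mem_Luk_iff {p : B → Prop} (hp : IsPt p) {f : Pow n B} (d : Divs n) :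
    hp.evalPow.toFun f ∈ Luk d.1 ↔ ∀ q : Idx d.1, p (xi d q f) := by
  have hn : (0 : ℝ) < n := by exact_mod_cast NeZero.pos n
  have hd : (0 : ℝ) < d.1 := by exact_mod_cast d.pos
  have hm := d.div_pos
  have hdm := d.mul_div
  have hdm' : (d.1 : ℝ) * (n / d.1 : ℕ) = n := by exact_mod_cast hdm
  obtain ⟨v, hv⟩ := hp.exists_cut f
  have hvn := hv.1
  have h1 : hp.evalPow.toFun f ∈ Luk d.1 ↔ n / d.1 ∣ v := by
    constructor
    · rintro ⟨k, hk, e⟩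
      rw [hp.coe_evalPow_of_isCut hv, div_eq_div_iff hn.ne' hd.ne', ← hdm'] at e
      have e' : (n - v) * d.1 = k * (d.1 * (n / d.1)) := by exact_mod_cast e
      have e2 : n - v = k * (n / d.1) := by
        refine Nat.eq_of_mul_eq_mul_right d.pos ?_
        rw [e']; ring
      have h2 : n / d.1 ∣ n - v := ⟨k, by rw [e2, mul_comm]⟩
      have h3 : n / d.1 ∣ n := ⟨d.1, by rw [mul_comm]; exact hdm.symm⟩
      exact (Nat.dvd_sub_iff_right hvn h3).1 h2
    · rintro ⟨c, hc⟩
      have hcd : c ≤ d.1 := by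
        refine Nat.le_of_mul_le_mul_left (c := n / d.1) ?_ hm
        rw [← hc, mul_comm, hdm]; exact hvn
      refine ⟨d.1 - c, Nat.sub_le _ _, ?_⟩
      rw [hp.coe_evalPow_of_isCut hv, div_eq_div_iff hn.ne' hd.ne', ← hdm',
        Nat.cast_sub hvn, Nat.cast_sub hcd, ← hdm', hc]
      push_cast
      ring
  have h2 : ∀ q : Idx d.1, p (xi d q f) ↔ (v < q.1 * (n / d.1) → v ≤ (q.1 - 1) * (n / d.1)) := by
    intro q
    unfold xi
    rw [hp.himp, hv.2, hv.2]
    exact imp_congr Iff.rfl Nat.lt_succ_iff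
  simp only [h1, h2]
  constructor
  · rintro ⟨c, rfl⟩ q hq
    rw [mul_comm] at hq ⊢
    have := lt_of_mul_lt_mul_right hq (Nat.zero_le _)
    exact Nat.mul_le_mul_right _ (by omega)
  · intro h
    rcases hvn.eq_or_lt with rfl | hlt
    · exact ⟨d.1, by rw [mul_comm]; exact hdm.symm⟩
    · have hq : v / (n / d.1) < d.1 := by
        rw [Nat.div_lt_iff_lt_mul hm, hdm]; exact hlt
      have := h ⟨v / (n / d.1) + 1, Nat.le_add_left _ _, hq⟩ (by
        have := Nat.lt_mul_div_succ v hm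
        rwa [mul_comm] at this)
      dsimp only at this
      rw [Nat.add_sub_cancel] at this
      have h3 := Nat.div_mul_le_self v (n / d.1)
      exact ⟨v / (n / d.1), by rw [mul_comm]; omega⟩

end Cut

theorem Hom.map_eq_zero_or_one {A : Type*} [WajsbergAlgebra A] (g : Hom A unitInterval)
    (b : BooleanPart A) : g.toFun b.1 = zero ∨ g.toFun b.1 = one :=
  eq_zero_or_one_of_idem (by rw [← g.map_odot, b.2])

/-- A homomorphism into `[0,1]` induces a point of `B(A)`. -/
theorem Hom.isPt {A : Type*} [WajsbergAlgebra A] (g : Hom A unitInterval) :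
    IsPt (fun b : BooleanPart A => g.toFun b.1 = one) where
  inf a b := by
    change g.toFun (wedge a.1 b.1) = one ↔ _
    rw [g.map_wedge]
    simp only [Subtype.ext_iff, coe_wedge, coe_one]
    have := (g.toFun a.1).2.2
    have := (g.toFun b.1).2.2
    constructor
    · intro h
      exact ⟨le_antisymm ‹_› (h ▸ min_le_left _ _), le_antisymm ‹_› (h ▸ min_le_right _ _)⟩
    · rintro ⟨h, h'⟩; rw [h, h', min_self]
  compl a := by
    change g.toFun ∼a.1 = one ↔ _
    rw [g.map_neg]
    rcases g.map_eq_zero_or_one a with h | h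
    · rw [h]; unfold zero; rw [neg_neg']
      exact ⟨fun _ => zero_ne_one_unitInterval, fun _ => rfl⟩
    · rw [h]
      exact ⟨fun h => absurd h zero_ne_one_unitInterval, fun h => absurd rfl h⟩
  top := g.map_one

/-! ### The homomorphism `x ↦ (σ_1(x), …, σ_n(x))` -/

section SigmaHom

variable {n : ℕ} [NeZero n] {A : Type*} [WajsbergAlgebra A] (hA : IsValued n A)

/-- `σ_i(x)` as an element of `B(A)`. -/
def IsValued.sigmaB (i : ℕ) (x : A) : BooleanPart A := ⟨sigma n i x, hA.sigma_idem i x⟩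

/-- `(σ_1(x), …, σ_n(x))` as an element of `B(A)^{[n]}`. -/
def IsValued.sigmaFun (x : A) : Pow n (BooleanPart A) :=
  ⟨fun i => hA.sigmaB i.1 x, fun i j h => hA.sigma_le (show i.1 ≤ j.1 from h) x⟩

theorem IsValued.sigmaB_iff {p : BooleanPart A → Prop} (hp : IsPt p) {x : A} {v : ℕ}
    (h : IsCut p (hA.sigmaFun x) v) {i : ℕ} (hi : i ≤ n + 1) : p (hA.sigmaB i x) ↔ v < i := by
  have hv := h.1
  rcases Nat.eq_zero_or_pos i with rfl | h0
  · have e : hA.sigmaB 0 x = ⊥ := Subtype.ext (hA.sigma_zero x)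
    rw [e]
    exact ⟨fun h => absurd h hp.not_bot, fun h => by omega⟩
  · rcases hi.eq_or_lt with rfl | h1
    · have e : hA.sigmaB (n + 1) x = ⊤ := Subtype.ext (hA.sigma_succ x)
      rw [e]
      exact ⟨fun _ => by omega, fun _ => hp.top⟩
    · exact h.2 ⟨i, h0, by omega⟩

/-- The map `x ↦ (σ_1(x), …, σ_n(x))` as a homomorphism from `A` to `B(A)^{[n]}`. -/
def IsValued.sigmaHom : Hom A (Pow n (BooleanPart A)) where
  toFun := hA.sigmaFun
  map_imp x y := pow_ext fun p hp v' w' hv' hw' => by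
    obtain ⟨v, hv⟩ := hp.exists_cut (hA.sigmaFun x)
    obtain ⟨w, hw⟩ := hp.exists_cut (hA.sigmaFun y)
    have hvn := hv.1
    have hwn := hw.1
    rw [hw'.unique (hp.cut_imp hv hw)]
    refine hv'.unique ⟨by omega, fun k => ?_⟩
    have hk := k.2
    change p (hA.sigmaB k.1 (x ⇝ y)) ↔ _
    constructor
    · intro h
      by_contra hc
      have h1 : hA.sigmaB k.1 (x ⇝ y) ≤ hA.sigmaB (v + 1) x ⇨ hA.sigmaB (v + k.1) y :=
        hA.sigma_imp_le (by omega) x y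
      have h2 := hp.mono h1 h
      rw [hp.himp, hA.sigmaB_iff hp hv (by omega), hA.sigmaB_iff hp hw (by omega)] at h2
      omega
    · intro h
      have h1 : (hA.sigmaB v x)ᶜ ≤ hA.sigmaB (w + 1) y ⇨ hA.sigmaB k.1 (x ⇝ y) :=
        hA.le_sigma_imp (by omega) hk.1 x y
      have h2 := hp.mono h1 ((hp.compl _).2 (by rw [hA.sigmaB_iff hp hv (by omega)]; omega))
      rw [hp.himp, hA.sigmaB_iff hp hw (by omega)] at h2
      exact h2 (by omega)
  map_neg x := OrderHom.ext _ _ (funext fun k =>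
    Subtype.ext (hA.sigma_neg (by have := k.2; omega) x))
  map_one := OrderHom.ext _ _ (funext fun k => Subtype.ext (hA.sigma_one k.2.1))

theorem IsValued.sigmaHom_injective : Function.Injective hA.sigmaHom.toFun := by
  refine hA.sigmaHom.injective_of_ker fun x hx => one_le ?_
  have h1 : sigma n 1 x = one :=
    congrArg (fun f : Pow n (BooleanPart A) => (f ⟨1, le_rfl, NeZero.pos n⟩).1) hx
  have h2 := hA.sigma_one_le x
  rwa [h1] at h2

/-- The homomorphism `A → L_{n+1}` of a point of `B(A)`. -/
noncomputable def IsValued.ptHom {p : BooleanPart A → Prop} (hp : IsPt p) : Hom A unitInterval :=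
  hp.evalPow.comp hA.sigmaHom

theorem IsValued.ptHom_mem {p : BooleanPart A → Prop} (hp : IsPt p) (x : A) :
    (hA.ptHom hp).toFun x ∈ Luk n := hp.evalPow_mem _

theorem IsPt.of_evalPow_eq_one {B : Type*} [BooleanAlgebra B] {p : B → Prop} (hp : IsPt p)
    {f : Pow n B} (h : hp.evalPow.toFun f = one) (i : Idx n) : p (f i) := by
  rw [← (hp.evalPow (n := n)).map_one] at h
  exact (hp.evalPow_eq_iff.1 h i).2 hp.top

theorem IsValued.ptHom_idem {p : BooleanPart A → Prop} (hp : IsPt p) (b : BooleanPart A) :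
    (hA.ptHom hp).toFun b.1 = one ↔ p b := by
  have key : ∀ b : BooleanPart A, (hA.ptHom hp).toFun b.1 = one → p b := by
    intro b h
    have h1 : p (hA.sigmaB 1 b.1) := hp.of_evalPow_eq_one (n := n) h ⟨1, le_rfl, NeZero.pos n⟩
    exact hp.mono (show hA.sigmaB 1 b.1 ≤ b from hA.sigma_one_le b.1) h1
  refine ⟨key b, fun h => ?_⟩
  by_contra hc
  exact (hp.compl b).1 (key bᶜ (((hA.ptHom hp).isPt.compl b).2 hc)) h

/-- Every homomorphism into `L_{n+1}` comes from a point of `B(A)`. -/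
theorem IsValued.ptHom_isPt (g : Hom A unitInterval) (hg : ∀ x, g.toFun x ∈ Luk n) (x : A) :
    (hA.ptHom g.isPt).toFun x = g.toFun x := by
  obtain ⟨j, hj, e⟩ := hg x
  refine Subtype.ext ?_
  have hc : IsCut (fun b : BooleanPart A => g.toFun b.1 = one) (hA.sigmaHom.toFun x) (n - j) := by
    refine ⟨Nat.sub_le _ _, fun i => ?_⟩
    change g.toFun (sigma n i.1 x) = one ↔ _
    rw [g.map_sigma, sigma_eq_ite (NeZero.pos n) _ e]
    split_ifs with h
    · exact ⟨fun _ => by omega, fun _ => rfl⟩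
    · exact ⟨fun h => absurd h zero_ne_one_unitInterval, fun _ => by omega⟩
  rw [e]
  refine (g.isPt.coe_evalPow_of_isCut hc).trans ?_
  rw [Nat.sub_sub_self hj]

include hA in
/-- The homomorphisms into `L_{d+1}` form a closed set. -/
theorem IsValued.mem_Luk_of_hA {d : Divs n} (g : Hom A unitInterval) (hg : ∀ x, g.toFun x ∈ Luk n)
    (h : ∀ b ∈ WajsbergAlgebra.hA n A d, g.toFun b.1 = one) (x : A) : g.toFun x ∈ Luk d.1 := by
  rw [← hA.ptHom_isPt g hg x]
  refine (g.isPt.evalPow_mem_Luk_iff d).2 fun q => h _ (mem_hA_iff.2 fun g' hg' => ?_)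
  have hg'' : ∀ x, g'.toFun x ∈ Luk n := fun x =>
    Luk_mono d.pos (NeZero.pos n) (Nat.dvd_of_mem_divisors d.2) (hg' x)
  refine (g'.isPt.evalPow_mem_Luk_iff d).1 ?_ q
  have := hA.ptHom_isPt g' hg'' x
  exact this ▸ hg' x

end SigmaHom


/-- The range of a homomorphism into `L_{n+1}` is `L_{d+1}` for a divisor `d` of `n`. -/
theorem Hom.exists_range_eq_Luk {n : ℕ} [NeZero n] {A : Type*} [WajsbergAlgebra A]
    (g : Hom A unitInterval) (hg : ∀ x, g.toFun x ∈ Luk n) :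
    ∃ d : Divs n, Set.range g.toFun = Luk d.1 := by
  classical
  have hn := NeZero.pos n
  have hn' : (0 : ℝ) < n := by exact_mod_cast hn
  have hex : ∃ j : ℕ, 0 < j ∧ ∃ x, (g.toFun x : ℝ) = j / n :=
    ⟨n, hn, one, by rw [g.map_one, coe_one, div_self hn'.ne']⟩
  obtain ⟨m, hm⟩ : ∃ m, m = Nat.find hex := ⟨_, rfl⟩
  obtain ⟨hm0, a, ha⟩ := hm ▸ Nat.find_spec hex
  have hmin : ∀ j : ℕ, 0 < j → ∀ x, (g.toFun x : ℝ) = j / n → m ≤ j := fun j h0 x hx =>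
    hm ▸ Nat.find_min' hex ⟨h0, x, hx⟩
  have hdvd : ∀ j : ℕ, ∀ x, (g.toFun x : ℝ) = j / n → m ∣ j := by
    intro j
    induction j using Nat.strong_induction_on with
    | _ j ih =>
      intro x hx
      rcases Nat.eq_zero_or_pos j with rfl | h0
      · exact dvd_zero m
      · have hle := hmin j h0 x hx
        refine (Nat.dvd_sub_iff_left hle dvd_rfl).1 (ih (j - m) (by omega) ∼(x ⇝ a) ?_)
        rw [g.map_neg, g.map_imp, coe_neg, coe_imp, hx, ha, Nat.cast_sub hle]
        have : (m : ℝ) / n ≤ j / n := by gcongr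
        rw [min_eq_right (by linarith)]
        ring
  have hmn : m ∣ n := hdvd n one (by rw [g.map_one, coe_one, div_self hn'.ne'])
  obtain ⟨d, hd⟩ := hmn
  have hd0 : 0 < d := Nat.pos_of_mul_pos_left (hd ▸ hn)
  have hd' : (0 : ℝ) < d := by exact_mod_cast hd0
  have hm' : (0 : ℝ) < m := by exact_mod_cast hm0
  have hnd : (n : ℝ) = m * d := by exact_mod_cast hd
  refine ⟨⟨d, Nat.mem_divisors.2 ⟨⟨m, by rw [mul_comm]; exact hd⟩, hn.ne'⟩⟩,
    Set.Subset.antisymm ?_ ?_⟩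
  · rintro _ ⟨x, rfl⟩
    obtain ⟨j, hj, e⟩ := hg x
    obtain ⟨k, rfl⟩ := hdvd j x e
    refine (mem_Luk_iff hd0).2 ⟨k, ?_⟩
    rw [e, hnd]
    push_cast
    field_simp
  · have hmul : ∀ k : ℕ, k ≤ d → ∃ x, (g.toFun x : ℝ) = k / d := by
      intro k
      induction k with
      | zero => intro _; exact ⟨zero, by rw [g.map_zero, coe_zero]; simp⟩
      | succ k ih =>
        intro hk
        obtain ⟨x, hx⟩ := ih (by omega)
        refine ⟨oplus x a, ?_⟩
        have e : (k : ℝ) / d + m / n = ((k + 1 : ℕ) : ℝ) / d := by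
          rw [hnd]; push_cast; field_simp
        rw [g.map_oplus, coe_oplus, hx, ha, e, min_eq_right]
        exact div_le_one_of_le₀ (by exact_mod_cast hk) hd'.le
    rintro y ⟨k, hk, e⟩
    obtain ⟨x, hx⟩ := hmul k hk
    exact ⟨x, Subtype.ext (hx.trans e.symm)⟩

section Valued

variable {n : ℕ} [NeZero n] {A : Type*} [WajsbergAlgebra A] (hA : IsValued n A)

theorem IsValued.sigmaHom_mem (x : A) :
    hA.sigmaHom.toFun x ∈ (M n (BooleanPart A) (WajsbergAlgebra.hA n A)).carrier := by
  intro d q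
  refine mem_hA_iff.2 fun g hg => ?_
  have hg' : ∀ x, g.toFun x ∈ Luk n := fun x =>
    Luk_mono d.pos (NeZero.pos n) (Nat.dvd_of_mem_divisors d.2) (hg x)
  refine (g.isPt.evalPow_mem_Luk_iff d).1 ?_ q
  have := hA.ptHom_isPt g hg' x
  exact this ▸ hg x

theorem vee_wedge_neg_of_eq_one {b : unitInterval} (hb : b = one) (x y : unitInterval) :
    vee (wedge b x) (wedge ∼b y) = x := by
  subst hb
  refine Subtype.ext ?_
  have := x.2.1; have := x.2.2; have := y.2.1
  rw [coe_vee, coe_wedge, coe_wedge, coe_neg, coe_one]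
  rw [min_eq_right ‹_›, min_eq_left (by linarith), max_eq_left (by linarith)]

theorem vee_wedge_neg_of_eq_zero {b : unitInterval} (hb : b = zero) (x y : unitInterval) :
    vee (wedge b x) (wedge ∼b y) = y := by
  subst hb
  refine Subtype.ext ?_
  have := x.2.1; have := y.2.1; have := y.2.2
  rw [coe_vee, coe_wedge, coe_wedge, coe_neg, coe_zero]
  rw [min_eq_left ‹_›, min_eq_right (by linarith), max_eq_right (by linarith)]

/-- The elements of `B(A)` on which `f` agrees with some `(σ_1(a), …, σ_n(a))`. -/
def IsValued.agreeIdeal (f : Pow n (BooleanPart A)) : Ideal (BooleanPart A) where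
  carrier := {b | ∃ a : A, ∀ (p : BooleanPart A → Prop) (hp : IsPt p), p b →
    (hA.ptHom hp).toFun a = hp.evalPow.toFun f}
  lower' := by
    rintro b c hcb ⟨a, ha⟩
    exact ⟨a, fun p hp hc => ha p hp (hp.mono hcb hc)⟩
  nonempty' := ⟨⊥, one, fun p hp h => absurd h hp.not_bot⟩
  directed' := by
    rintro b ⟨x, hx⟩ c ⟨y, hy⟩
    refine ⟨b ⊔ c, ⟨vee (wedge b.1 x) (wedge ∼b.1 y), fun p hp h => ?_⟩, le_sup_left, le_sup_right⟩
    rw [Hom.map_vee, Hom.map_wedge, Hom.map_wedge, Hom.map_neg]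
    by_cases hb : p b
    · rw [vee_wedge_neg_of_eq_one ((hA.ptHom_idem hp b).2 hb), hx p hp hb]
    · have h0 : (hA.ptHom hp).toFun b.1 = zero :=
        ((hA.ptHom hp).map_eq_zero_or_one b).resolve_right
          fun h => hb ((hA.ptHom_idem hp b).1 h)
      rw [vee_wedge_neg_of_eq_zero h0, hy p hp (((hp.sup b c).1 h).resolve_left hb)]

theorem IsValued.exists_sigmaHom_eq {f : Pow n (BooleanPart A)}
    (hf : f ∈ (M n (BooleanPart A) (WajsbergAlgebra.hA n A)).carrier) :
    ∃ a, hA.sigmaHom.toFun a = f := by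
  by_cases htop : (⊤ : BooleanPart A) ∈ hA.agreeIdeal f
  · obtain ⟨a, ha⟩ := htop
    exact ⟨a, pow_ext_eval fun p hp => ha p hp hp.top⟩
  · exfalso
    obtain ⟨p, hp, -, h2⟩ := exists_pt_of_disjoint (F := PFilter.principal ⊤)
      (I := hA.agreeIdeal f) (Set.disjoint_left.2 fun x hx hx' => htop (by
        rwa [top_le_iff.1 (PFilter.mem_principal.1 hx)] at hx'))
    obtain ⟨d, hd⟩ := (hA.ptHom hp).exists_range_eq_Luk (hA.ptHom_mem hp)
    have h3 : hp.evalPow.toFun f ∈ Luk d.1 := (hp.evalPow_mem_Luk_iff d).2 fun q =>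
      (hA.ptHom_idem hp _).1
        (mem_hA_iff.1 (hf d q) (hA.ptHom hp) fun x => hd ▸ Set.mem_range_self x)
    rw [← hd] at h3
    obtain ⟨a, ha⟩ := h3
    -- a neighbourhood of the point on which `f` agrees with `a`
    have hfin : ∀ s : Finset (Idx n), ∃ b : BooleanPart A, p b ∧
        ∀ (p' : BooleanPart A → Prop), IsPt p' → p' b →
          ∀ i ∈ s, p' (hA.sigmaHom.toFun a i) ↔ p' (f i) := by
      classical
      intro s
      induction s using Finset.induction_on with
      | empty => exact ⟨⊤, hp.top, fun _ _ _ i hi => by simp at hi⟩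
      | insert i s hi ih =>
        obtain ⟨b, hb, hb'⟩ := ih
        refine ⟨b ⊓ ((hA.sigmaHom.toFun a i ⇨ f i) ⊓ (f i ⇨ hA.sigmaHom.toFun a i)), ?_, ?_⟩
        · have := hp.evalPow_eq_iff.1 ha i
          rw [hp.inf, hp.inf, hp.himp, hp.himp]
          exact ⟨hb, this.1, this.2⟩
        · intro p' hp' h j hj
          rw [hp'.inf, hp'.inf, hp'.himp, hp'.himp] at h
          rcases Finset.mem_insert.1 hj with rfl | hj
          · exact ⟨h.2.1, h.2.2⟩
          · exact hb' p' hp' h.1 j hj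
    have : Finite (Idx n) := ((Set.finite_Icc 1 n).subset fun i hi => hi).to_subtype
    have := Fintype.ofFinite (Idx n)
    obtain ⟨b, hb, hb'⟩ := hfin Finset.univ
    exact h2 b ⟨a, fun p' hp' h => hp'.evalPow_eq_iff.2 fun i => hb' p' hp' h i (Finset.mem_univ _)⟩
      hb

/-- The isomorphism `x ↦ (σ_1(x), …, σ_n(x))`. -/
noncomputable def IsValued.sigmaIso :
    Iso A (M n (BooleanPart A) (WajsbergAlgebra.hA n A)).Elem :=
  Iso.ofBijective
    { toFun := fun x => ⟨hA.sigmaHom.toFun x, hA.sigmaHom_mem x⟩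
      map_imp := fun _ _ => Subtype.ext (hA.sigmaHom.map_imp _ _)
      map_neg := fun x => Subtype.ext (hA.sigmaHom.map_neg x)
      map_one := Subtype.ext hA.sigmaHom.map_one }
    ⟨fun _ _ h => hA.sigmaHom_injective (congrArg Subtype.val h), fun f => by
      obtain ⟨a, ha⟩ := hA.exists_sigmaHom_eq f.2
      exact ⟨a, Subtype.ext ha⟩⟩

include hA in
theorem IsValued.isBPair : IsBPair n (BooleanPart A) (WajsbergAlgebra.hA n A) where
  map_top := by
    refine Set.Subset.antisymm (fun b hb => ?_) ?_
    · by_contra hc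
      obtain ⟨p, hp, -, h2⟩ := exists_pt (a := (⊤ : BooleanPart A)) (b := b)
        fun h => hc (top_le_iff.1 h)
      exact h2 ((hA.ptHom_idem hp b).1 (mem_hA_iff.1 hb _ (hA.ptHom_mem hp)))
    · rintro _ rfl
      exact PFilter.top_mem
  map_gcd d e := by
    have hmono : ∀ c : Divs n, (d.gcd e).1 ∣ c.1 →
        WajsbergAlgebra.hA n A c ≤ WajsbergAlgebra.hA n A (d.gcd e) := fun c hc b hb =>
      mem_hA_iff.2 fun g hg => mem_hA_iff.1 hb g fun x => Luk_mono (d.gcd e).pos c.pos hc (hg x)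
    refine ⟨?_, fun F hF b hb => ?_⟩
    · rintro F (rfl | rfl)
      · exact hmono _ (Nat.gcd_dvd_left _ _)
      · exact hmono _ (Nat.gcd_dvd_right _ _)
    · refine mem_iff_forall_stone.2 fun U hU => ?_
      have hU := mem_delta.1 hU
      have hmem : ∀ c : Divs n, WajsbergAlgebra.hA n A c ≤ F →
          ∀ x, (hA.ptHom U.isPt).toFun x ∈ Luk c.1 := fun c hc =>
        hA.mem_Luk_of_hA _ (hA.ptHom_mem U.isPt) fun b hb =>
          (hA.ptHom_idem U.isPt b).2 (hU (hc hb))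
      refine (hA.ptHom_idem U.isPt b).1 (mem_hA_iff.1 hb _ fun x => ?_)
      exact mem_Luk_gcd d.pos e.pos (hmem d (hF (Or.inl rfl)) x) (hmem e (hF (Or.inr rfl)) x)

include hA in
theorem IsValued.sigmaIso_holds : SigmaIso n A := ⟨hA.sigmaIso, fun _ _ => rfl⟩

end Valued

theorem isValued_of_iso_pow {n : ℕ} [NeZero n] {B : Type*} [BooleanAlgebra B] (S : Subalg (Pow n B))
    {A : Type*} [WajsbergAlgebra A] (φ : Iso A S.Elem) : IsValued n A :=
  isValued_of_separating fun _ _ h => φ.toEquiv.injective (Subtype.ext (pow_ext_eval fun _ hp =>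
    h (hp.evalPow.comp (S.incl.comp φ.hom)) fun _ => hp.evalPow_mem _))

theorem isValued_of_iso_Cfun {n : ℕ} [NeZero n] {X : Type*} [TopologicalSpace X]
    {h : Divs n → TopologicalSpace.Closeds X} {A : Type*} [WajsbergAlgebra A]
    (φ : Iso A (Cfun n X h).Elem) : IsValued n A :=
  isValued_of_separating fun _ _ hxy => φ.toEquiv.injective (Subtype.ext (funext fun t =>
    hxy ((evalHom unitInterval t).comp ((Cfun n X h).incl.comp φ.hom))
      fun z => (φ.toEquiv z).2.2.1 t))


/-! ### Stone duality -/

section Stone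

variable {B : Type*} [BooleanAlgebra B]

theorem isOpen_stoneSet (a : B) : IsOpen (stoneSet a : Set (StoneSpace B)) :=
  TopologicalSpace.isOpen_generateFrom_of_mem ⟨a, rfl⟩

theorem isClopen_stoneSet (a : B) : IsClopen (stoneSet a : Set (StoneSpace B)) :=
  ⟨isClosed_stoneSet a, isOpen_stoneSet a⟩

theorem stoneSet_subset_iff {a b : B} : stoneSet a ⊆ stoneSet b ↔ a ≤ b := by
  constructor
  · intro h
    by_contra hc
    obtain ⟨p, hp, h1, h2⟩ := exists_pt hc
    exact h2 (h (show hp.toStone ∈ stoneSet a from h1))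
  · exact fun h U hU => PFilter.mem_of_le h hU

theorem isTopologicalBasis_stoneSet :
    TopologicalSpace.IsTopologicalBasis (Set.range (stoneSet (B := B))) := by
  have h := TopologicalSpace.isTopologicalBasis_of_subbasis_of_inter
    (r := Set.range (stoneSet (B := B))) rfl ?_
  · rwa [Set.insert_eq_of_mem] at h
    exact ⟨⊤, Set.eq_univ_of_forall fun U => U.isPt.top⟩
  · rintro _ ⟨a, rfl⟩ _ ⟨b, rfl⟩
    exact ⟨a ⊓ b, Set.ext fun U => U.isPt.inf a b⟩

instance : CompactSpace (StoneSpace B) := by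
  refine ⟨isCompact_iff_ultrafilter_le_nhds.2 fun 𝓤 _ => ?_⟩
  have hp : IsPt (fun b : B => stoneSet b ∈ 𝓤) :=
    { inf := fun a b => by
        have : stoneSet (a ⊓ b) = stoneSet a ∩ stoneSet b := Set.ext fun U => U.isPt.inf a b
        change stoneSet (a ⊓ b) ∈ (𝓤 : Filter _) ↔ _
        rw [this]; exact Filter.inter_mem_iff
      compl := fun a => by
        have : stoneSet aᶜ = (stoneSet a)ᶜ := Set.ext fun U => U.isPt.compl a
        rw [this]; exact Ultrafilter.compl_mem_iff_notMem
      top := by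
        have : stoneSet (⊤ : B) = Set.univ := Set.eq_univ_of_forall fun U => U.isPt.top
        rw [this]; exact Filter.univ_mem }
  refine ⟨hp.toStone, trivial, ?_⟩
  rw [TopologicalSpace.nhds_generateFrom]
  refine le_iInf₂ ?_
  rintro _ ⟨h, ⟨b, rfl⟩⟩
  exact Filter.le_principal_iff.2 h

instance : TotallySeparatedSpace (StoneSpace B) := by
  refine ⟨fun U _ V _ hUV => ?_⟩
  obtain ⟨b, h1, h2⟩ : ∃ b, b ∈ U.1 ∧ b ∉ V.1 := by
    by_contra hc
    push Not at hc
    exact hUV (StoneSpace.ext hc)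
  exact ⟨stoneSet b, stoneSet bᶜ, isOpen_stoneSet _, isOpen_stoneSet _, h1, (V.isPt.compl b).2 h2,
    fun W _ => by
      by_cases h : b ∈ W.1
      · exact Or.inl h
      · exact Or.inr ((W.isPt.compl b).2 h),
    Set.disjoint_left.2 fun W h h' => (W.isPt.compl b).1 h' h⟩

theorem exists_stoneSet_eq {C : Set (StoneSpace B)} (hC : IsClopen C) : ∃ b, stoneSet b = C := by
  obtain ⟨b, h1, h2⟩ : ∃ b, C ⊆ stoneSet b ∧ stoneSet b ⊆ C := by
    refine IsCompact.induction_on (p := fun t => ∃ b, t ⊆ stoneSet b ∧ stoneSet b ⊆ C)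
      hC.isClosed.isCompact ?_ ?_ ?_ ?_
    · exact ⟨⊥, Set.empty_subset _, fun U hU => absurd hU U.isPt.not_bot⟩
    · rintro s t hst ⟨b, h1, h2⟩
      exact ⟨b, hst.trans h1, h2⟩
    · rintro s t ⟨b, h1, h2⟩ ⟨c, h3, h4⟩
      refine ⟨b ⊔ c, ?_, fun U hU => ((U.isPt.sup b c).1 hU).elim (fun h => h2 h) fun h => h4 h⟩
      exact Set.union_subset (h1.trans (stoneSet_subset_iff.2 le_sup_left))
        (h3.trans (stoneSet_subset_iff.2 le_sup_right))
    · intro U hU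
      obtain ⟨_, ⟨b, rfl⟩, h1, h2⟩ :=
        isTopologicalBasis_stoneSet.exists_subset_of_mem_open hU hC.isOpen
      exact ⟨stoneSet b, mem_nhdsWithin_of_mem_nhds ((isOpen_stoneSet b).mem_nhds h1), b,
        Set.Subset.rfl, h2⟩
  exact ⟨b, h2.antisymm h1⟩

theorem delta_le_delta_iff {F G : PFilter B} : delta F ≤ delta G ↔ G ≤ F := by
  constructor
  · exact fun h b hb => mem_iff_forall_stone.2 fun U hU => mem_delta.1 (h hU) hb
  · exact fun h U hU => mem_delta.2 (h.trans (mem_delta.1 hU))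

theorem delta_bijective : Function.Bijective (delta (B := B)) := by
  constructor
  · intro F G h
    exact le_antisymm (delta_le_delta_iff.1 h.ge) (delta_le_delta_iff.1 h.le)
  · intro C
    have hF : IsPFilter {b : B | (C : Set (StoneSpace B)) ⊆ stoneSet b} :=
      IsPFilter.of_def ⟨⊤, fun U _ => U.isPt.top⟩
        (fun x hx y hy => ⟨x ⊓ y, fun U hU => (U.isPt.inf x y).2 ⟨hx hU, hy hU⟩, inf_le_left,
          inf_le_right⟩)
        (fun h hx => hx.trans (stoneSet_subset_iff.2 h))
    refine ⟨hF.toPFilter, TopologicalSpace.Closeds.ext (Set.Subset.antisymm (fun U hU => ?_)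
      fun U hU => mem_delta.2 fun b hb => hb hU)⟩
    by_contra hc
    obtain ⟨_, ⟨b, rfl⟩, h1, h2⟩ :=
      isTopologicalBasis_stoneSet.exists_subset_of_mem_open hc C.isClosed.isOpen_compl
    have hb : bᶜ ∈ hF.toPFilter := fun V hV => (V.isPt.compl b).2 fun h => h2 h hV
    exact (U.isPt.compl b).1 (mem_delta.1 hU hb) h1

/-- A homeomorphism between Stone spaces comes from an isomorphism of Boolean algebras. -/
theorem exists_orderIso_of_homeomorph {B' : Type*} [BooleanAlgebra B']
    (θ : StoneSpace B ≃ₜ StoneSpace B') :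
    ∃ φ : B ≃o B', ∀ b U, φ b ∈ (θ U).1 ↔ b ∈ U.1 := by
  have hex : ∀ b : B, ∃ b' : B', stoneSet b' = θ.symm ⁻¹' stoneSet b := fun b =>
    exists_stoneSet_eq ((isClopen_stoneSet b).preimage θ.symm.continuous)
  choose f hf using hex
  have hf' : ∀ b U, f b ∈ (θ U).1 ↔ b ∈ U.1 := fun b U => by
    change θ U ∈ stoneSet (f b) ↔ U ∈ stoneSet b
    rw [hf, Set.mem_preimage, θ.symm_apply_apply]
  have hle : ∀ a b, f a ≤ f b ↔ a ≤ b := fun a b => by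
    rw [← stoneSet_subset_iff (a := f a), ← stoneSet_subset_iff (a := a), hf a, hf b,
      θ.symm.surjective.preimage_subset_preimage_iff]
  have hsurj : Function.Surjective f := fun b' => by
    obtain ⟨b, hb⟩ := exists_stoneSet_eq ((isClopen_stoneSet b').preimage θ.continuous)
    refine ⟨b, le_antisymm ?_ ?_⟩ <;>
    · rw [← stoneSet_subset_iff, hf, hb, ← Set.preimage_comp]
      simp
  exact ⟨RelIso.ofSurjective (OrderEmbedding.ofMapLEIff f hle) hsurj, hf'⟩

theorem bPairIso_of_spaceIso {n : ℕ} {B' : Type*} [BooleanAlgebra B'] {h : Divs n → PFilter B}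
    {h' : Divs n → PFilter B'} (hs : SpaceIso (fun d => delta (h d)) fun d => delta (h' d)) :
    BPairIso h h' := by
  obtain ⟨θ, hθ⟩ := hs
  obtain ⟨φ, hφ⟩ := exists_orderIso_of_homeomorph θ
  refine ⟨φ, fun d => Set.ext fun b => ?_⟩
  have h1 : ∀ U, θ U ∈ delta (h' d) ↔ U ∈ delta (h d) := fun U => Set.ext_iff.1 (hθ d) U
  change φ b ∈ h' d ↔ b ∈ h d
  rw [mem_iff_forall_stone, mem_iff_forall_stone]
  refine ⟨fun H U hU => (hφ b U).1 (H _ ((h1 U).2 hU)), fun H V hV => ?_⟩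
  obtain ⟨U, rfl⟩ := θ.surjective V
  exact (hφ b U).2 (H U ((h1 U).1 hV))

end Stone

/-! ### The isomorphism between `M(B,h)` and the algebra of continuous functions -/

section Psi

theorem isClopen_preimage_of_Luk {n : ℕ} {X : Type*} [TopologicalSpace X] {f : X → unitInterval}
    (hf : Continuous f) (hfn : ∀ x, f x ∈ Luk n) (S : Set unitInterval) : IsClopen (f ⁻¹' S) := by
  have key : ∀ S : Set unitInterval, IsClosed (f ⁻¹' S) := fun S => by
    have : f ⁻¹' S = f ⁻¹' (S ∩ Luk n) := by
      ext x; simp [hfn x]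
    rw [this]
    exact ((finite_Luk n).inter_of_right S).isClosed.preimage hf
  exact ⟨key S, by rw [← isClosed_compl_iff, ← Set.preimage_compl]; exact key Sᶜ⟩

variable {n : ℕ} [NeZero n] {B : Type*} [BooleanAlgebra B]

theorem IsBPair.isValuedBooleanSpace {h : Divs n → PFilter B} (hB : IsBPair n B h) :
    IsValuedBooleanSpace n (StoneSpace B) fun d => delta (h d) where
  compact := inferInstance
  hausdorff := inferInstance
  totallyDisconnected := inferInstance
  map_gcd d e := by
    refine TopologicalSpace.Closeds.ext (Set.ext fun U => ?_)
    change U ∈ delta _ ↔ U ∈ delta _ ∧ U ∈ delta _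
    rw [mem_delta, mem_delta, mem_delta, isLUB_le_iff (hB.map_gcd d e)]
    simp [upperBounds]
  map_top := by
    refine TopologicalSpace.Closeds.ext (Set.eq_univ_of_forall fun U => mem_delta.2 fun b hb => ?_)
    have hb' : b ∈ (h (Divs.top n) : Set B) := hb
    rw [hB.map_top] at hb'
    rw [Set.mem_singleton_iff.1 hb']
    exact U.isPt.top

/-- The function `g̃` on the Stone space. -/
noncomputable def tilde (g : Pow n B) (U : StoneSpace B) : unitInterval := U.isPt.evalPow.toFun g

theorem isTilde_tilde (g : Pow n B) : IsTilde g (tilde g) := by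
  have hn : (n : ℝ) ≠ 0 := by exact_mod_cast NeZero.ne n
  intro U
  have hc := U.isPt.isCut g
  have hcn := hc.1
  have e : (tilde g U : ℝ) = ((n - U.isPt.cut g : ℕ) : ℝ) / n := rfl
  refine ⟨fun i hi h => ?_, fun k i j hk1 hk2 hi hj h => ?_, fun i hi h => ?_⟩
  · have := (hc.2 i).1 h
    rw [e, show U.isPt.cut g = 0 by omega, Nat.sub_zero, div_self hn]
  · have h1 := (hc.2 i).1 h.1
    have h2 : ¬U.isPt.cut g < j.1 := fun h' => h.2 ((hc.2 j).2 h')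
    rw [e, show n - U.isPt.cut g = k by omega]
  · have : ¬U.isPt.cut g < i.1 := fun h' => h ((hc.2 i).2 h')
    rw [e, show n - U.isPt.cut g = 0 by omega, Nat.cast_zero, zero_div]

theorem continuous_tilde (g : Pow n B) : Continuous (tilde g) := by
  have : Finite (Idx n) := ((Set.finite_Icc 1 n).subset fun i hi => hi).to_subtype
  refine IsLocallyConstant.continuous ((IsLocallyConstant.iff_eventually_eq _).2 fun U => ?_)
  have h : ∀ᶠ V : StoneSpace B in nhds U, ∀ i, g i ∈ V.1 ↔ g i ∈ U.1 := by
    rw [Filter.eventually_all]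
    intro i
    by_cases hi : g i ∈ U.1
    · filter_upwards [(isOpen_stoneSet (g i)).mem_nhds hi] with V hV
      exact ⟨fun _ => hi, fun _ => hV⟩
    · filter_upwards [(isClosed_stoneSet (g i)).isOpen_compl.mem_nhds hi] with V hV
      exact ⟨fun h => absurd h hV, fun h => absurd h hi⟩
  filter_upwards [h] with V hV
  have hc : IsCut (fun b => b ∈ V.1) g (U.isPt.cut g) :=
    ⟨(U.isPt.isCut g).1, fun i => (hV i).trans ((U.isPt.isCut g).2 i)⟩
  exact Subtype.ext (V.isPt.coe_evalPow_of_isCut hc)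

theorem tilde_mem_Cfun_iff {h : Divs n → PFilter B} (g : Pow n B) :
    tilde g ∈ (Cfun n (StoneSpace B) fun d => delta (h d)).carrier ↔ g ∈ (M n B h).carrier := by
  constructor
  · intro hg d q
    refine mem_iff_forall_stone.2 fun U hU => ?_
    exact (U.isPt.evalPow_mem_Luk_iff d).1 (hg.2.2 d U hU) q
  · intro hg
    exact ⟨continuous_tilde g, fun U => U.isPt.evalPow_mem g, fun d U hU =>
      (U.isPt.evalPow_mem_Luk_iff d).2 fun q => mem_delta.1 hU (hg d q)⟩

theorem exists_tilde_eq {f : StoneSpace B → unitInterval} (hf : Continuous f)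
    (hfn : ∀ U, f U ∈ Luk n) : ∃ g : Pow n B, tilde g = f := by
  have hn : (0 : ℝ) < n := by exact_mod_cast NeZero.pos n
  have hex : ∀ i : Idx n, ∃ b : B, stoneSet b = {U | (n : ℝ) < i.1 + n * (f U : ℝ)} := fun i =>
    exists_stoneSet_eq (isClopen_preimage_of_Luk hf hfn {x | (n : ℝ) < i.1 + n * (x : ℝ)})
  choose g hg using hex
  refine ⟨⟨g, fun i j hij => stoneSet_subset_iff.1 ?_⟩, funext fun U => ?_⟩
  · rw [hg, hg]
    intro U hU
    have : (i.1 : ℝ) ≤ j.1 := by exact_mod_cast (show i.1 ≤ j.1 from hij)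
    have hU' : (n : ℝ) < i.1 + n * (f U : ℝ) := hU
    change (n : ℝ) < j.1 + n * (f U : ℝ)
    linarith
  · obtain ⟨j, hj, e⟩ := hfn U
    refine Subtype.ext ?_
    rw [e]
    refine (U.isPt.coe_evalPow_of_isCut (v := n - j) ⟨Nat.sub_le _ _, fun i => ?_⟩).trans ?_
    · change U ∈ stoneSet (g i) ↔ _
      rw [hg]
      change (n : ℝ) < i.1 + n * (f U : ℝ) ↔ _
      rw [e, mul_div_cancel₀ _ hn.ne']
      norm_cast
      omega
    · rw [Nat.sub_sub_self hj]

/-- The isomorphism `Ψ : g ↦ g̃`. -/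
noncomputable def tildeIso (h : Divs n → PFilter B) :
    Iso (M n B h).Elem (Cfun n (StoneSpace B) fun d => delta (h d)).Elem :=
  Iso.ofBijective
    { toFun := fun g => ⟨tilde g.1, (tilde_mem_Cfun_iff g.1).2 g.2⟩
      map_imp := fun _ _ => Subtype.ext (funext fun U => U.isPt.evalPow.map_imp _ _)
      map_neg := fun _ => Subtype.ext (funext fun U => U.isPt.evalPow.map_neg _)
      map_one := Subtype.ext (funext fun U => U.isPt.evalPow.map_one) }
    ⟨fun _ _ e => Subtype.ext (pow_ext_eval fun _ hp =>
        congrFun (congrArg Subtype.val e) hp.toStone),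
      fun f => by
        obtain ⟨g, hg⟩ := exists_tilde_eq f.2.1 f.2.2.1
        exact ⟨⟨g, (tilde_mem_Cfun_iff g).1 (hg ▸ f.2)⟩, Subtype.ext hg⟩⟩

end Psi

/-! ### Representing spaces -/

section Space

theorem zero_mem_Luk (d : ℕ) : zero ∈ Luk d := ⟨0, Nat.zero_le _, by rw [coe_zero]; simp⟩

variable {n : ℕ} [NeZero n] {X : Type*} [TopologicalSpace X]
  {h : Divs n → TopologicalSpace.Closeds X}

open Classical in
theorem bump_mem_Cfun {N : Set X} (hN : IsClopen N) {c : unitInterval} (hc : c ∈ Luk n)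
    (hd : ∀ d : Divs n, ∀ x ∈ h d, x ∈ N → c ∈ Luk d.1) :
    (fun x => if x ∈ N then c else zero) ∈ (Cfun n X h).carrier := by
  refine ⟨?_, fun x => ?_, fun d x hx => ?_⟩
  · refine IsLocallyConstant.continuous ((IsLocallyConstant.iff_eventually_eq _).2 fun x => ?_)
    by_cases hx : x ∈ N
    · filter_upwards [hN.isOpen.mem_nhds hx] with y hy
      rw [if_pos hy, if_pos hx]
    · filter_upwards [hN.isClosed.isOpen_compl.mem_nhds hx] with y hy
      rw [if_neg hy, if_neg hx]
  · dsimp only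
    split_ifs
    exacts [hc, zero_mem_Luk n]
  · dsimp only
    split_ifs with hx'
    exacts [hd d x hx hx', zero_mem_Luk _]

/-- The divisors `d` with `x ∈ h(d)` are the multiples of one of them. -/
theorem IsValuedBooleanSpace.exists_least (hX : IsValuedBooleanSpace n X h) (x : X) :
    ∃ m : Divs n, ∀ d, x ∈ h d ↔ m.1 ∣ d.1 := by
  classical
  have hex : ∃ k, ∃ d : Divs n, d.1 = k ∧ x ∈ h d :=
    ⟨n, Divs.top n, rfl, by rw [hX.map_top]; trivial⟩
  obtain ⟨k, hk⟩ : ∃ k, k = Nat.find hex := ⟨_, rfl⟩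
  obtain ⟨m, hm, hx⟩ := hk ▸ Nat.find_spec hex
  have hg : ∀ d, x ∈ h (m.gcd d) ↔ x ∈ h d := fun d => by
    rw [hX.map_gcd]; exact ⟨fun h => h.2, fun h => ⟨hx, h⟩⟩
  refine ⟨m, fun d => ⟨fun hd => ?_, fun hd => ?_⟩⟩
  · have h1 : k ≤ (m.gcd d).1 := hk ▸ Nat.find_min' hex ⟨m.gcd d, rfl, (hg d).2 hd⟩
    have h2 : (m.gcd d).1 ≤ m.1 := Nat.gcd_le_left _ m.pos
    have h3 : Nat.gcd m.1 d.1 = m.1 := le_antisymm h2 (hm.le.trans h1)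
    exact h3 ▸ Nat.gcd_dvd_right m.1 d.1
  · rw [← hg d, show m.gcd d = m from Subtype.ext (Nat.gcd_eq_left hd)]
    exact hx

/-- A space that represents `A` is isomorphic to the Stone space of `B(A)`. -/
theorem IsValuedBooleanSpace.spaceIso (hX : IsValuedBooleanSpace n X h) {A : Type*}
    [WajsbergAlgebra A] (φ : Iso A (Cfun n X h).Elem) :
    SpaceIso h fun d => delta (hA n A d) := by
  classical
  have := hX.compact
  have := hX.hausdorff
  have := hX.totallyDisconnected
  have hn := NeZero.pos n
  have hV : IsValued n A := isValued_of_iso_Cfun φ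
  let ev : X → Hom A unitInterval := fun x =>
    (evalHom unitInterval x).comp ((Cfun n X h).incl.comp φ.hom)
  have hev : ∀ x a, (ev x).toFun a ∈ Luk n := fun x a => (φ.toFun a).2.2.1 x
  have hevs : ∀ f : (Cfun n X h).Elem, ∀ x, (ev x).toFun (φ.toEquiv.symm f) = f.1 x := fun f x =>
    congrFun (congrArg Subtype.val (φ.toEquiv.apply_symm_apply f)) x
  have hext : ∀ a b : A, (∀ x, (ev x).toFun a = (ev x).toFun b) → a = b := fun a b hab =>
    φ.toEquiv.injective (Subtype.ext (funext hab))
  let θ : X → StoneSpace (BooleanPart A) := fun x => (ev x).isPt.toStone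
  have hθ : ∀ b x, b ∈ (θ x).1 ↔ (ev x).toFun b.1 = one := fun b x => Iff.rfl
  have hcont : Continuous θ := by
    refine continuous_generateFrom_iff.2 ?_
    rintro _ ⟨b, rfl⟩
    exact (isClopen_preimage_of_Luk (φ.toFun b.1).2.1 (φ.toFun b.1).2.2.1 {one}).isOpen
  have hinj : Function.Injective θ := by
    intro x y hxy
    by_contra hne
    obtain ⟨N, hN, hxN, hyN⟩ := exists_isClopen_of_totally_separated hne
    let f : (Cfun n X h).Elem := ⟨_, bump_mem_Cfun hN (one_mem_Luk hn)
      fun d _ _ _ => one_mem_Luk d.pos⟩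
    let b : BooleanPart A := ⟨φ.toEquiv.symm f, hext _ _ fun z => by
      rw [Hom.map_odot, hevs]
      change odot (if z ∈ N then one else zero) (if z ∈ N then one else zero) =
        if z ∈ N then one else zero
      split_ifs
      exacts [one_odot_one, neg_idem one_odot_one]⟩
    have h1 : b ∈ (θ x).1 := (hθ b x).2 ((hevs f x).trans (if_pos hxN))
    rw [hxy, hθ, hevs f y] at h1
    exact zero_ne_one_unitInterval ((if_neg hyN).symm.trans h1)
  have hsurj : Function.Surjective θ := by
    intro U
    by_contra hc
    obtain ⟨_, ⟨b, rfl⟩, h1, h2⟩ := isTopologicalBasis_stoneSet.exists_subset_of_mem_open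
      (show U ∈ (Set.range θ)ᶜ from hc) (isCompact_range hcont).isClosed.isOpen_compl
    have hb : b = ⊥ := Subtype.ext (hext _ _ fun x => by
      rw [show (⊥ : BooleanPart A).1 = zero from rfl, Hom.map_zero]
      exact ((ev x).map_eq_zero_or_one b).resolve_right
        fun h => h2 (show θ x ∈ stoneSet b from h) ⟨x, rfl⟩)
    rw [hb] at h1
    exact U.isPt.not_bot h1
  refine ⟨Continuous.homeoOfEquivCompactToT2 (f := Equiv.ofBijective θ ⟨hinj, hsurj⟩) hcont,
    fun d => Set.ext fun x => ?_⟩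
  change θ x ∈ delta (hA n A d) ↔ x ∈ h d
  rw [mem_delta]
  constructor
  · intro hx
    have hd : ∀ a, (ev x).toFun a ∈ Luk d.1 := hV.mem_Luk_of_hA (ev x) (hev x) hx
    obtain ⟨m, hm⟩ := hX.exists_least x
    have hm' : (0 : ℝ) < m.1 := by exact_mod_cast m.pos
    -- a clopen neighbourhood of `x` that meets only the sets `h(e)` containing `x`
    have hopen : IsOpen (⋂ e ∈ {e : Divs n | x ∉ h e}, (h e : Set X)ᶜ) :=
      (Set.toFinite _).isOpen_biInter fun e _ => (h e).isClosed.isOpen_compl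
    obtain ⟨N, hN, hxN, hNs⟩ := compact_exists_isClopen_in_isOpen hopen
      (Set.mem_iInter₂.2 fun e he => he)
    have hNe : ∀ e, ∀ y ∈ h e, y ∈ N → x ∈ h e := fun e y hy hyN => by
      by_contra hc
      exact Set.mem_iInter₂.1 (hNs hyN) e hc hy
    let c : unitInterval := ⟨1 / m.1, by positivity,
      div_le_one_of_le₀ (by exact_mod_cast m.pos) hm'.le⟩
    have hcm : c ∈ Luk m.1 := ⟨1, m.pos, by simp [c]⟩
    let f : (Cfun n X h).Elem := ⟨_, bump_mem_Cfun (h := h) hN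
      (Luk_mono m.pos hn (Nat.dvd_of_mem_divisors m.2) hcm)
      fun e y hy hyN => Luk_mono m.pos e.pos ((hm e).1 (hNe e y hy hyN)) hcm⟩
    have h1 := hd (φ.toEquiv.symm f)
    rw [hevs, show f.1 x = c from if_pos hxN] at h1
    obtain ⟨z, hz⟩ := (mem_Luk_iff d.pos).1 h1
    refine (hm d).2 (Int.natCast_dvd_natCast.1 ⟨z, ?_⟩)
    have h2 : (d.1 : ℝ) = m.1 * z := by
      rw [← hz]; change (d.1 : ℝ) = m.1 * (d.1 * (1 / m.1)); field_simp
    exact_mod_cast h2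
  · intro hx b hb
    exact mem_hA_iff.1 hb (ev x) fun a => (φ.toFun a).2.2.2 d x hx

end Space

theorem SpaceIso.trans_symm {n : ℕ} {X Y Z : Type*} [TopologicalSpace X] [TopologicalSpace Y]
    [TopologicalSpace Z] {h : Divs n → TopologicalSpace.Closeds X}
    {g : Divs n → TopologicalSpace.Closeds Y} {k : Divs n → TopologicalSpace.Closeds Z}
    (hk : SpaceIso h k) (gk : SpaceIso g k) : SpaceIso h g := by
  obtain ⟨φ, hφ⟩ := hk
  obtain ⟨ψ, hψ⟩ := gk
  refine ⟨φ.trans ψ.symm, fun d => ?_⟩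
  rw [← hφ, ← hψ, ← Set.preimage_comp]
  congr 1
  ext x
  simp

theorem IsValued.represents {n : ℕ} [NeZero n] {A : Type*} [WajsbergAlgebra A]
    (hV : IsValued n A) :
    Represents n A (StoneSpace (BooleanPart A)) fun d => delta (hA n A d) :=
  ⟨hV.isBPair.isValuedBooleanSpace, ⟨hV.sigmaIso.trans (tildeIso _)⟩⟩

theorem IsValued.uniquelyRepresentable {n : ℕ} [NeZero n] {A : Type u} [WajsbergAlgebra A]
    (hV : IsValued n A) : UniquelyRepresentable.{u, v, w} n A := by
  refine ⟨⟨_, _, _, hV.represents⟩, fun X Y _ _ h g => ?_, fun X _ h => ?_⟩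
  · rintro ⟨hX, ⟨φ⟩⟩ ⟨hY, ⟨ψ⟩⟩
    exact (hX.spaceIso φ).trans_symm (hY.spaceIso ψ)
  · rintro ⟨hX, ⟨φ⟩⟩
    exact ⟨(hX.spaceIso φ).choose⟩

end WajsbergAlgebra

theorem mainTheorem6 (n : ℕ) [NeZero n] :
    -- for each Wajsberg algebra, the two representation statements are equivalent
    (∀ (A : Type u) [WajsbergAlgebra A],
      WajsbergAlgebra.SigmaIso n A ↔ WajsbergAlgebra.UniquelyRepresentable.{u, v, w} n A) ∧
    -- both of them hold for each `(n+1)`-valued algebra, and `⟨χ(B(A)), δ ∘ h_A⟩` represents `A`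
    (∀ (A : Type u) [WajsbergAlgebra A], WajsbergAlgebra.IsValued n A →
      WajsbergAlgebra.SigmaIso n A ∧ WajsbergAlgebra.UniquelyRepresentable.{u, v, w} n A ∧
      WajsbergAlgebra.IsBPair n (WajsbergAlgebra.BooleanPart A) (WajsbergAlgebra.hA n A) ∧
      WajsbergAlgebra.Represents n A
        (WajsbergAlgebra.StoneSpace (WajsbergAlgebra.BooleanPart A))
        (fun d => WajsbergAlgebra.delta (WajsbergAlgebra.hA n A d))) ∧
    -- a pair `⟨B, h⟩` is determined by `M(B,h)`, and so by the algebra of continuous functions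
    (∀ (B : Type u) [BooleanAlgebra B] (h : WajsbergAlgebra.Divs n → PFilter B),
      WajsbergAlgebra.IsBPair n B h →
      WajsbergAlgebra.BPairIso h (WajsbergAlgebra.hA n (WajsbergAlgebra.M n B h).Elem) ∧
      ∀ (A : Type u) [WajsbergAlgebra A],
        Nonempty (WajsbergAlgebra.Iso A (WajsbergAlgebra.Cfun n (WajsbergAlgebra.StoneSpace B)
          (fun d => WajsbergAlgebra.delta (h d))).Elem) →
        WajsbergAlgebra.BPairIso h (WajsbergAlgebra.hA n A)) ∧
    -- `δ` is an order-antiisomorphism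
    (∀ (B : Type u) [BooleanAlgebra B],
      Function.Bijective (WajsbergAlgebra.delta (B := B)) ∧
      ∀ F G : PFilter B, WajsbergAlgebra.delta F ≤ WajsbergAlgebra.delta G ↔ G ≤ F) ∧
    -- the isomorphism `Ψ`
    (∀ (B : Type u) [BooleanAlgebra B] (h : WajsbergAlgebra.Divs n → PFilter B),
      WajsbergAlgebra.IsBPair n B h →
      WajsbergAlgebra.IsValuedBooleanSpace n (WajsbergAlgebra.StoneSpace B)
        (fun d => WajsbergAlgebra.delta (h d)) ∧
      ∃ Ψ : WajsbergAlgebra.Iso (WajsbergAlgebra.M n B h).Elem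
          (WajsbergAlgebra.Cfun n (WajsbergAlgebra.StoneSpace B)
            (fun d => WajsbergAlgebra.delta (h d))).Elem,
        ∀ g, WajsbergAlgebra.IsTilde g.1 (Ψ.toFun g).1) := by
  open WajsbergAlgebra in
  refine ⟨fun A _ => ⟨fun ⟨φ, _⟩ => (isValued_of_iso_pow _ φ).uniquelyRepresentable,
      fun ⟨⟨_, _, _, _, ⟨φ⟩⟩, _⟩ => (isValued_of_iso_Cfun φ).sigmaIso_holds⟩,
    fun A _ hV => ⟨hV.sigmaIso_holds, hV.uniquelyRepresentable, hV.isBPair, hV.represents⟩,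
    fun B _ h hB => ?_, fun B _ => ⟨delta_bijective, fun _ _ => delta_le_delta_iff⟩,
    fun B _ h hB => ⟨hB.isValuedBooleanSpace, tildeIso h, fun g => isTilde_tilde g.1⟩⟩
  have key : ∀ (A : Type u) [WajsbergAlgebra A],
      Nonempty (Iso A (Cfun n (StoneSpace B) fun d => delta (h d)).Elem) → BPairIso h (hA n A) :=
    fun A _ ⟨φ⟩ => bPairIso_of_spaceIso (hB.isValuedBooleanSpace.spaceIso φ)
  exact ⟨key _ ⟨tildeIso h⟩, key⟩
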